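/- Let $n\ge 2$, $d=n-1$. Let $\widetilde\sigma,\widetilde\lambda:[0,\infty)\to\mathbb R$ be continuous and bounded from below by positive constants. Write points of $\mathbb R^{d}\times\mathbb R^{d}$ as $(X',V)$, let $X^n\ge 0$, and let $\mathcal S'=\mathcal S'(\mathbb R^{2d})$ be the space of (complex-valued) tempered distributions in $(X',V)$; limits, derivatives and integrals of $\mathcal S'$-valued functions are understood after pairing with each Schwartz function. For every $F\in C([0,\infty);\mathcal S')$ and every $G\in\mathcal S'$ there exists a unique $U\in C^1([0,\infty);\mathcal S')$ (one-sided derivative at $X^n=0$) solving the Fermi pencil-beam equation $$-\widetilde\sigma(X^n)\Delta_V U+V\cdot\nabla_{X'}U+\partial_{X^n}U+\widetilde\lambda(X^n)U=F\quad (X^n>0),\qquad U|_{X^n=0}=G .$$ Moreover, for every $X^n>0$, $U$ is given by $$U(X^n)=e^{-\int_0^{X^n}\widetilde\lambda(s)\,ds}\,\tau_{X^nV}\big(\mathbf H_1*G\big)+\int_0^{X^n}e^{-\int_t^{X^n}\widetilde\lambda(s)\,ds}\,\tau_{X^nV}\big(\mathbf H_2(t)*\tau_{-tV}F(t)\big)\,dt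 ,$$ where the integrand, paired with any Schwartz function, is integrable in $t$ on $(0,X^n)$. Here $*$ is convolution in $(X',V)$; $\tau_{cV}$ is the translation $[\tau_{cV}f](X',V)=f(X'-cV,V)$, extended to $\mathcal S'$ by duality; for $0\le t<X^n$ and $k=0,1,2$, $\widetilde E_k=\widetilde E_k(X^n;t)=\int_t^{X^n}s^k\,\widetilde\sigma(s)\,ds$, $$\mathbf H_2(t)(X',V)=\frac{\exp\!\Big(-\frac{1}{4(\widetilde E_2\widetilde E_0-\widetilde E_1^2)}\big(\widetilde E_0|X'|^2+2\widetilde E_1\,X'\cdot V+\widetilde E_2|V|^2\big)\Big)}{\big(4\pi\sqrt{\widetilde E_2\widetilde E_0-\widetilde E_1^2}\big)^{d}},$$ and $\mathbf H_1$ is given by the same formula with $\widetilde E_k(X^n;t)$ replaced by $E_k(X^n)=\int_0^{X^n}s^k\,\widetilde\sigma(s)\,ds$. -/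

import Mathlib

open MeasureTheory Set Filter Topology
open scoped SchwartzMap LineDeriv

noncomputable section

namespace PencilBeam

/-- The transversal phase space `ℝ^d × ℝ^d` (with `d = n - 1`); a point is `(X', V)`, with
`X' = z.fst` and `V = z.snd`. -/
abbrev Phase (d : ℕ) : Type :=
  WithLp 2 (EuclideanSpace ℝ (Fin d) × EuclideanSpace ℝ (Fin d))

/-- The unit vector of `Phase d` in the direction of the coordinate `X'_i`. -/
def eX {d : ℕ} (i : Fin d) : Phase d := WithLp.toLp 2 (EuclideanSpace.single i 1, 0)

/-- The unit vector of `Phase d` in the direction of the coordinate `V_i`. -/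
def eV {d : ℕ} (i : Fin d) : Phase d := WithLp.toLp 2 (0, EuclideanSpace.single i 1)

/-- `Δ_V U`, the Laplacian in the variable `V`. -/
def laplacianV {d : ℕ} (U : 𝓢'(Phase d, ℂ)) : 𝓢'(Phase d, ℂ) :=
  ∑ i : Fin d, ∂_{(eV i : Phase d)} (∂_{(eV i : Phase d)} U)

/-- `V · ∇_{X'} U`, with `V_i` acting by multiplication. -/
def transport {d : ℕ} (U : 𝓢'(Phase d, ℂ)) : 𝓢'(Phase d, ℂ) :=
  ∑ i : Fin d, TemperedDistribution.smulLeftCLM ℂ (fun z : Phase d => ((z.snd i : ℝ) : ℂ))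
    (∂_{(eX i : Phase d)} U)

/-- The linear bijection `(X', V) ↦ (X' + c V, V)`. -/
def shear {d : ℕ} (c : ℝ) : Phase d ≃L[ℝ] Phase d :=
    { toFun := fun z => WithLp.toLp 2 (z.fst + c • z.snd, z.snd)
      invFun := fun z => WithLp.toLp 2 (z.fst - c • z.snd, z.snd)
      map_add' := fun x y => WithLp.ofLp_injective 2 (Prod.ext (by
        change x.fst + y.fst + c • (x.snd + y.snd) = x.fst + c • x.snd + (y.fst + c • y.snd)
        module) rfl)
      map_smul' := fun a x => WithLp.ofLp_injective 2 (Prod.ext (by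
        change a • x.fst + c • a • x.snd = a • (x.fst + c • x.snd)
        module) rfl)
      left_inv := fun z => WithLp.ofLp_injective 2 (Prod.ext (by
        change z.fst + c • z.snd - c • z.snd = z.fst
        module) rfl)
      right_inv := fun z => WithLp.ofLp_injective 2 (Prod.ext (by
        change z.fst - c • z.snd + c • z.snd = z.fst
        module) rfl)
      continuous_toFun := by fun_prop
      continuous_invFun := by fun_prop }

/-- The translation `τ_{cV}`, on functions `[τ_{cV} f](X', V) = f(X' - c V, V)`, extended to
tempered distributions by duality: `⟨τ_{cV} T, φ⟩ = ⟨T, φ(X' + c V, V)⟩`. -/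
def translate {d : ℕ} (c : ℝ) (T : 𝓢'(Phase d, ℂ)) : 𝓢'(Phase d, ℂ) :=
  PointwiseConvergenceCLM.precomp ℂ
    (SchwartzMap.compCLMOfContinuousLinearEquiv ℂ (shear c)) T

/-- The convolution `K * T` of a Schwartz function with a tempered distribution:
`⟨K * T, φ⟩ = ⟨T, K(-·) * φ⟩`. -/
def conv {d : ℕ} (K : 𝓢(Phase d, ℂ)) (T : 𝓢'(Phase d, ℂ)) : 𝓢'(Phase d, ℂ) :=
  PointwiseConvergenceCLM.precomp ℂ
    (SchwartzMap.convolution (ContinuousLinearMap.mul ℂ ℂ)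
      (SchwartzMap.compCLMOfContinuousLinearEquiv ℂ (ContinuousLinearEquiv.neg ℝ) K)) T

/-- The Gaussian with moments `E₀, E₁, E₂`, as a function on phase space. -/
def gaussian {d : ℕ} (E₀ E₁ E₂ : ℝ) (z : Phase d) : ℝ :=
  Real.exp (-(1 / (4 * (E₂ * E₀ - E₁ ^ 2)) *
      (E₀ * ‖z.fst‖ ^ 2 + 2 * E₁ * inner ℝ z.fst z.snd + E₂ * ‖z.snd‖ ^ 2))) /
    (4 * Real.pi * √(E₂ * E₀ - E₁ ^ 2)) ^ d

theorem exists_schwartz_exp_neg {d : ℕ} {q : Phase d → ℝ} (hq : q.HasTemperateGrowth) {c : ℝ}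
    (hc : 0 < c) (hqc : ∀ z, c * ‖z‖ ^ 2 ≤ q z) :
    ∃ K : 𝓢(Phase d, ℝ), ∀ z, K z = Real.exp (-q z) := by
  have hq' : (fun z => -q z).HasTemperateGrowth := hq.neg
  refine ⟨⟨Real.exp ∘ fun z => -q z, Real.contDiff_exp.comp hq'.1, fun k n => ?_⟩, fun z => rfl⟩
  obtain ⟨l, C, hC, hgr⟩ := hq'.norm_iteratedFDeriv_le_uniform n
  have key : ∀ r : ℝ, (1 + r) ≤ 1 + 1 / (4 * c) + c * r ^ 2 := fun r => by
    have h : 1 / (4 * c) + c * r ^ 2 - r = c * (r - 1 / (2 * c)) ^ 2 := by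
      field_simp
      ring
    nlinarith [mul_nonneg hc.le (sq_nonneg (r - 1 / (2 * c)))]
  refine ⟨(n.factorial : ℝ) * (C + 1) ^ n * (((k + l * n).factorial : ℝ) *
    Real.exp (1 + 1 / (4 * c))), fun z => ?_⟩
  have h1 := norm_iteratedFDeriv_comp_le (n := n) (N := (⊤ : ℕ∞)) (C := Real.exp (-q z))
    (D := (C + 1) * (1 + ‖z‖) ^ l) Real.contDiff_exp hq'.1 (mod_cast le_top) z
    (fun i _ => by
      rw [norm_iteratedFDeriv_eq_norm_iteratedDeriv, iteratedDeriv_eq_iterate,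
        Real.iter_deriv_exp, Real.norm_eq_abs, abs_of_pos (Real.exp_pos _)])
    (fun i hi1 hi => by
      refine (hgr i hi z).trans ?_
      have hp : (1 : ℝ) ≤ (1 + ‖z‖) ^ l := one_le_pow₀ (by simp)
      have hA : (1 : ℝ) ≤ (C + 1) * (1 + ‖z‖) ^ l := by nlinarith
      calc C * (1 + ‖z‖) ^ l ≤ (C + 1) * (1 + ‖z‖) ^ l := by gcongr; simp
        _ ≤ _ := le_self_pow₀ hA (by omega))
  have h2 : (1 + ‖z‖) ^ (k + l * n) ≤ ((k + l * n).factorial : ℝ) * Real.exp (1 + ‖z‖) := by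
    have := Real.pow_div_factorial_le_exp (1 + ‖z‖) (by positivity) (k + l * n)
    rwa [div_le_iff₀ (by positivity), mul_comm (Real.exp _)] at this
  have h3 : Real.exp (1 + ‖z‖) * Real.exp (-q z) ≤ Real.exp (1 + 1 / (4 * c)) := by
    rw [← Real.exp_add]
    apply Real.exp_le_exp.2
    linarith [key ‖z‖, hqc z]
  have hk : ‖z‖ ^ k ≤ (1 + ‖z‖) ^ k := by gcongr; simp
  calc ‖z‖ ^ k * ‖iteratedFDeriv ℝ n (Real.exp ∘ fun z => -q z) z‖
      ≤ (1 + ‖z‖) ^ k * (n.factorial * Real.exp (-q z) * ((C + 1) * (1 + ‖z‖) ^ l) ^ n) := by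
        gcongr
    _ = n.factorial * (C + 1) ^ n * ((1 + ‖z‖) ^ (k + l * n) * Real.exp (-q z)) := by
        rw [mul_pow, pow_add, pow_mul]
        ring
    _ ≤ n.factorial * (C + 1) ^ n *
        ((((k + l * n).factorial : ℝ) * Real.exp (1 + ‖z‖)) * Real.exp (-q z)) := by gcongr
    _ ≤ _ := by
        rw [mul_assoc (((k + l * n).factorial : ℝ))]
        gcongr

/-- The Gaussian is a Schwartz function when its covariance is positive definite. -/
theorem exists_schwartz_gaussian {d : ℕ} {E₀ E₁ E₂ : ℝ} (h₀ : 0 < E₀)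
    (hΔ : 0 < E₂ * E₀ - E₁ ^ 2) :
    ∃ K : 𝓢(Phase d, ℂ), ∀ z, K z = (gaussian E₀ E₁ E₂ z : ℂ) := by
  have h₂ : 0 < E₂ := by
    by_contra h
    nlinarith [sq_nonneg E₁, mul_nonneg h₀.le (neg_nonneg.2 (not_lt.1 h))]
  have hfst : (fun z : Phase d => z.fst).HasTemperateGrowth :=
    (WithLp.fstL 2 ℝ (EuclideanSpace ℝ (Fin d))
      (EuclideanSpace ℝ (Fin d))).hasTemperateGrowth
  have hsnd : (fun z : Phase d => z.snd).HasTemperateGrowth :=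
    (WithLp.sndL 2 ℝ (EuclideanSpace ℝ (Fin d))
      (EuclideanSpace ℝ (Fin d))).hasTemperateGrowth
  have hsq : ∀ x y : EuclideanSpace ℝ (Fin d), 2 * inner ℝ x y =
      ‖x + y‖ ^ 2 - ‖x‖ ^ 2 - ‖y‖ ^ 2 := fun x y => by
    rw [norm_add_sq_real]
    ring
  obtain ⟨K, hK⟩ := exists_schwartz_exp_neg (d := d) (c := 1 / (4 * (E₀ + E₂)))
    (q := fun z => 1 / (4 * (E₂ * E₀ - E₁ ^ 2)) *
      (E₀ * ‖z.fst‖ ^ 2 + 2 * E₁ * inner ℝ z.fst z.snd + E₂ * ‖z.snd‖ ^ 2)) (by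
      have : (fun z : Phase d => 1 / (4 * (E₂ * E₀ - E₁ ^ 2)) *
          (E₀ * ‖z.fst‖ ^ 2 + E₁ * (‖z.fst + z.snd‖ ^ 2 - ‖z.fst‖ ^ 2 - ‖z.snd‖ ^ 2)
            + E₂ * ‖z.snd‖ ^ 2)).HasTemperateGrowth := by
        have a1 := (Function.hasTemperateGrowth_norm_sq
          (H := EuclideanSpace ℝ (Fin d))).comp hfst
        have a2 := (Function.hasTemperateGrowth_norm_sq
          (H := EuclideanSpace ℝ (Fin d))).comp hsnd
        have a3 := (Function.hasTemperateGrowth_norm_sq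
          (H := EuclideanSpace ℝ (Fin d))).comp (hfst.add hsnd)
        exact (Function.HasTemperateGrowth.const _).mul
          ((((Function.HasTemperateGrowth.const _).mul a1).add
            ((Function.HasTemperateGrowth.const _).mul ((a3.sub a1).sub a2))).add
            ((Function.HasTemperateGrowth.const _).mul a2))
      convert this using 4 with z
      rw [← hsq]
      ring) (by positivity) (fun z => by
      have hn : ‖z‖ ^ 2 = ‖z.fst‖ ^ 2 + ‖z.snd‖ ^ 2 := WithLp.prod_norm_sq_eq_of_L2 z
      have e1 := sq_nonneg ‖E₀ • z.fst + E₁ • z.snd‖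
      have e2 := sq_nonneg ‖E₁ • z.fst + E₂ • z.snd‖
      rw [norm_add_sq_real] at e1 e2
      simp only [norm_smul, mul_pow, Real.norm_eq_abs, sq_abs, real_inner_smul_left,
        real_inner_smul_right] at e1 e2
      rw [hn, one_div_mul_eq_div, one_div_mul_eq_div, div_le_div_iff₀ (by positivity)
        (by positivity)]
      nlinarith)
  refine ⟨((4 * Real.pi * √(E₂ * E₀ - E₁ ^ 2)) ^ d)⁻¹ •
    SchwartzMap.postcompCLM (𝕜 := ℝ) Complex.ofRealCLM K, fun z => ?_⟩
  simp only [smul_apply, SchwartzMap.postcompCLM_apply, hK, gaussian,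
    Complex.ofRealCLM_apply, Complex.real_smul, ← Complex.ofReal_mul]
  congr 1
  exact (div_eq_inv_mul _ _).symm

open Classical in
/-- The Gaussian `gaussian E₀ E₁ E₂` as a Schwartz function, for `E₀ > 0` and
`E₂ E₀ - E₁² > 0`; in the degenerate case, where the Gaussian is not defined, it is set to `0`. -/
def gaussianKernel (d : ℕ) (E₀ E₁ E₂ : ℝ) : 𝓢(Phase d, ℂ) :=
  if h : 0 < E₀ ∧ 0 < E₂ * E₀ - E₁ ^ 2 then (exists_schwartz_gaussian h.1 h.2).choose else 0

theorem gaussianKernel_apply {d : ℕ} {E₀ E₁ E₂ : ℝ} (h₀ : 0 < E₀)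
    (hΔ : 0 < E₂ * E₀ - E₁ ^ 2) (z : Phase d) :
    gaussianKernel d E₀ E₁ E₂ z = (gaussian E₀ E₁ E₂ z : ℂ) := by
  rw [gaussianKernel, dif_pos ⟨h₀, hΔ⟩]
  exact (exists_schwartz_gaussian h₀ hΔ).choose_spec z

/-- The moments `E_k(x; t) = ∫_t^x s^k σ(s) ds`. -/
def moment (σ : ℝ → ℝ) (k : ℕ) (t x : ℝ) : ℝ := ∫ s in t..x, s ^ k * σ s

/-- The kernel `H₂(·; t)` at height `x = X^n`, for `0 ≤ t < x`. -/
def H₂ (d : ℕ) (σ : ℝ → ℝ) (x t : ℝ) : 𝓢(Phase d, ℂ) :=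
  gaussianKernel d (moment σ 0 t x) (moment σ 1 t x) (moment σ 2 t x)

/-- The kernel `H₁` at height `x = X^n > 0`. -/
def H₁ (d : ℕ) (σ : ℝ → ℝ) (x : ℝ) : 𝓢(Phase d, ℂ) :=
  gaussianKernel d (moment σ 0 0 x) (moment σ 1 0 x) (moment σ 2 0 x)

/-- `U'` is the derivative of `U : [0, ∞) → 𝓢'` at `x`: the difference quotients
`(U y - U x) / (y - x)`, `y ≥ 0`, `y ≠ x`, tend to `U'` in `𝓢'` as `y → x`. -/
def HasDeriv {d : ℕ} (U : ℝ → 𝓢'(Phase d, ℂ)) (U' : 𝓢'(Phase d, ℂ)) (x : ℝ) : Prop :=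
  Tendsto (fun y => (y - x)⁻¹ • (U y - U x)) (𝓝[Ici 0 \ {x}] x) (𝓝 U')

/-- `U ∈ C¹([0, ∞); 𝓢')`. -/
def IsC1 {d : ℕ} (U : ℝ → 𝓢'(Phase d, ℂ)) : Prop :=
  ∃ U' : ℝ → 𝓢'(Phase d, ℂ), ContinuousOn U' (Ici 0) ∧ ∀ x, 0 ≤ x → HasDeriv U (U' x) x

/-- `U` solves the Fermi pencil-beam equation
`-σ Δ_V U + V · ∇_{X'} U + ∂_{X^n} U + lam U = F` for `X^n = x > 0`, and `U = G` for `X^n = 0`. -/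
def IsSolution {d : ℕ} (σ lam : ℝ → ℝ) (F : ℝ → 𝓢'(Phase d, ℂ)) (G : 𝓢'(Phase d, ℂ))
    (U : ℝ → 𝓢'(Phase d, ℂ)) : Prop :=
  (∀ x : ℝ, 0 < x → ∃ U'x : 𝓢'(Phase d, ℂ), HasDeriv U U'x x ∧
    -(σ x • laplacianV (U x)) + transport (U x) + U'x + lam x • U x = F x) ∧
  U 0 = G

end PencilBeam

end

/-! Tested with Schwartz functions, the equation reads `u' = u ∘ A x + F x`, where `A x = σ Δ_V + V
· ∇_{X'} - lam` acts on the Schwartz space. After a Fourier transform, with `(ξ, η)` dual to `(X',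
V)`, `A x` becomes the first-order operator `-4π² σ |η|² - ξ · ∇_η - lam`, which is solved along the
characteristics `(ξ, η - c ξ)`. The resulting propagator `Q t x` sends `ψ = 𝓕 φ` to `exp (-∫_t^x
lam) exp (-4π² ∫_t^x σ(s) |η + t ξ - s ξ|² ds) ψ(ξ, η - (x - t) ξ)`. Apart from the shears, the
second exponent is a quadratic form whose coefficients are the moments `E_k`. For `t < x` this form
is positive definite by the strict Cauchy-Schwarz inequality, and its exponential is the Fourier
transform of the Gaussian `H₂`. This yields the explicit formula (`propagator_eq_convolution`).

The propagator satisfies `∂_x Q = Q ∘ A x` and `∂_t Q = -A t ∘ Q` (`isEvolution_propagator`). The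
first equation makes Duhamel's formula `G (Q 0 x φ) + ∫_0^x F t (Q t x φ) dt` a solution. The second
gives uniqueness: for any solution `W` the function `t ↦ W t (Q t x φ)` has derivative `F t (Q t x
φ)`.

The analytic point is that distributions and test functions vary together, while `𝓢'` only carries
pointwise convergence. The Schwartz space is complete and metrizable, hence barrelled, and
Banach-Steinhaus makes the pairing jointly sequentially continuous (`tendsto_apply_of_barrelled`).
Limits in the Schwartz topology are reduced to pointwise ones by `tendsto_of_forall_tendsto_apply`
(boundedness and pointwise convergence suffice) and `tendsto_slope_of_hasDerivAt_apply` (a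
continuous family of pointwise derivatives suffices). -/

noncomputable section

universe u

namespace SchwartzMap

/-! ### Completeness of the Schwartz space -/

section Completeness

variable {E F : Type*} [NormedAddCommGroup E] [NormedSpace ℝ E]
  [NormedAddCommGroup F] [NormedSpace ℝ F]

theorem tendsto_nhds_iff_seminorm {ι : Type*} {l : Filter ι} {f : ι → 𝓢(E, F)} {g : 𝓢(E, F)} :
    Tendsto f l (𝓝 g) ↔
      ∀ k n : ℕ, ∀ ε : ℝ, 0 < ε → ∀ᶠ i in l, SchwartzMap.seminorm ℝ k n (f i - g) < ε := by
  rw [(schwartz_withSeminorms ℝ E F).tendsto_nhds]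
  exact ⟨fun h k n => h (k, n), fun h i => h i.1 i.2⟩

theorem continuous_apply_const (z : E) : Continuous fun f : 𝓢(E, F) => f z := by
  have h : Continuous fun f : BoundedContinuousFunction E F => f z := continuous_eval_const z
  exact h.comp (toBoundedContinuousFunctionCLM ℝ E F).continuous

theorem seminorm_lt_of_cauchySeq {u : ℕ → 𝓢(E, F)} (hu : CauchySeq u) (k n : ℕ) {ε : ℝ}
    (hε : 0 < ε) : ∃ N, ∀ i, N ≤ i → ∀ j, N ≤ j → SchwartzMap.seminorm ℝ k n (u i - u j) < ε := by
  have h1 : Tendsto (fun p : ℕ × ℕ => u p.2 - u p.1) atTop (𝓝 0) := by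
    rw [cauchySeq_iff_tendsto, uniformity_eq_comap_nhds_zero, tendsto_comap_iff] at hu
    exact hu
  have h2 := tendsto_nhds_iff_seminorm.1 h1 k n ε hε
  obtain ⟨⟨N, M⟩, hN⟩ := eventually_atTop.1 h2
  refine ⟨max N M, fun i hi j hj => ?_⟩
  simpa using hN (j, i) ⟨(le_max_left _ _).trans hj, (le_max_right _ _).trans hi⟩

/-- Derivatives of every order converge uniformly, so their limits `g n` are the successive
derivatives of `g 0`; the weighted estimates survive the pointwise limit. -/
theorem exists_tendsto_of_cauchySeq [CompleteSpace F] {u : ℕ → 𝓢(E, F)} (hu : CauchySeq u) :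
    ∃ g : 𝓢(E, F), Tendsto u atTop (𝓝 g) := by
  have hc : ∀ n : ℕ, UniformCauchySeqOn (fun i z => iteratedFDeriv ℝ n (u i) z) atTop univ := by
    intro n
    rw [Metric.uniformCauchySeqOn_iff]
    intro ε hε
    obtain ⟨N, hN⟩ := seminorm_lt_of_cauchySeq hu 0 n hε
    refine ⟨N, fun i hi j hj z _ => lt_of_le_of_lt ?_ (hN i hi j hj)⟩
    have := norm_iteratedFDeriv_le_seminorm ℝ (u i - u j) n z
    rwa [FunLike.coe_sub, iteratedFDeriv_sub_apply ((u i).contDiffAt _) ((u j).contDiffAt _),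
      ← dist_eq_norm] at this
  choose g hg using fun (n : ℕ) (z : E) =>
    cauchySeq_tendsto_of_complete ((hc n).cauchySeq (mem_univ z))
  have hunif : ∀ n, TendstoUniformly (fun i z => iteratedFDeriv ℝ n (u i) z) (g n) atTop :=
    fun n => tendstoUniformlyOn_univ.1
      ((hc n).tendstoUniformlyOn_of_tendsto fun z _ => hg n z)
  have hder : ∀ n z, HasFDerivAt (g n) (g (n + 1) z).curryLeft z := by
    intro n z
    refine hasFDerivAt_of_tendstoUniformly (l := atTop)
      (f := fun i z => iteratedFDeriv ℝ n (u i) z)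
      (f' := fun i z => (iteratedFDeriv ℝ (n + 1) (u i) z).curryLeft)
      (g' := fun z => (g (n + 1) z).curryLeft) ?_ ?_ (hg n) z
    · exact (continuousMultilinearCurryLeftEquiv ℝ (fun _ : Fin (n + 1) => E) F
        ).isometry.uniformContinuous.comp_tendstoUniformly (hunif (n + 1))
    · intro i x
      exact ((u i).smooth ⊤).ftaylorSeries.fderiv n (by exact_mod_cast WithTop.coe_lt_top n) x
  have hT : HasFTaylorSeriesUpTo (⊤ : ℕ∞) (fun z => (g 0 z).curry0) (fun z n => g n z) :=
    ⟨fun z => rfl, fun m _ z => hder m z, fun m _ =>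
      continuous_iff_continuousAt.2 fun z => (hder m z).continuousAt⟩
  have heq : ∀ n z, iteratedFDeriv ℝ n (fun z => (g 0 z).curry0) z = g n z := fun n z =>
    (hT.eq_iteratedFDeriv (by exact_mod_cast le_top) z).symm
  -- Let `j → ∞` in the Cauchy estimate for `u i - u j`. This gives both the decay of the limit and
  -- the convergence in each seminorm.
  have hbd : ∀ k n : ℕ, ∀ ε : ℝ, 0 < ε → ∃ N, ∀ i, N ≤ i → ∀ z,
      ‖z‖ ^ k * ‖iteratedFDeriv ℝ n (u i) z - g n z‖ ≤ ε := by
    intro k n ε hε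
    obtain ⟨N, hN⟩ := seminorm_lt_of_cauchySeq hu k n hε
    refine ⟨N, fun i hi z => ?_⟩
    refine le_of_tendsto (((hg n z).const_sub (iteratedFDeriv ℝ n (u i) z)).norm.const_mul
      (‖z‖ ^ k)) (eventually_atTop.2 ⟨N, fun j hj => ?_⟩)
    have := (le_seminorm ℝ k n (u i - u j) z).trans (hN i hi j hj).le
    rwa [FunLike.coe_sub, iteratedFDeriv_sub_apply ((u i).contDiffAt _)
      ((u j).contDiffAt _)] at this
  let G : 𝓢(E, F) := ⟨fun z => (g 0 z).curry0, hT.contDiff, fun k n => by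
    obtain ⟨N, hN⟩ := hbd k n 1 one_pos
    refine ⟨1 + SchwartzMap.seminorm ℝ k n (u N), fun z => ?_⟩
    rw [heq]
    have h1 := hN N le_rfl z
    have h2 := le_seminorm ℝ k n (u N) z
    have h3 : ‖g n z‖ ≤ ‖iteratedFDeriv ℝ n (u N) z - g n z‖ + ‖iteratedFDeriv ℝ n (u N) z‖ := by
      simpa using norm_sub_le (iteratedFDeriv ℝ n (u N) z)
        (iteratedFDeriv ℝ n (u N) z - g n z) |>.trans (by rw [add_comm])
    nlinarith [pow_nonneg (norm_nonneg z) k]⟩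
  refine ⟨G, tendsto_nhds_iff_seminorm.2 fun k n ε hε => ?_⟩
  obtain ⟨N, hN⟩ := hbd k n (ε / 2) (half_pos hε)
  filter_upwards [eventually_ge_atTop N] with i hi
  refine lt_of_le_of_lt (seminorm_le_bound ℝ k n _ (half_pos hε).le fun z => ?_) (half_lt_self hε)
  rw [FunLike.coe_sub, iteratedFDeriv_sub_apply ((u i).contDiffAt _) (G.contDiffAt _)]
  have : iteratedFDeriv ℝ n G z = g n z := heq n z
  rw [this]
  exact hN i hi z

instance instIsCountablyGeneratedUniformity : (uniformity 𝓢(E, F)).IsCountablyGenerated := by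
  rw [uniformity_eq_comap_nhds_zero]
  infer_instance

instance instCompleteSpace [CompleteSpace F] : CompleteSpace 𝓢(E, F) :=
  UniformSpace.complete_of_cauchySeq_tendsto fun _ hu => exists_tendsto_of_cauchySeq hu

/-- A complete space with countably generated uniformity is completely pseudometrizable. The Baire
property supplies the barrelledness that Banach-Steinhaus requires. -/
instance instBaireSpace [CompleteSpace F] : BaireSpace 𝓢(E, F) := by
  let _ := UniformSpace.pseudoMetricSpace 𝓢(E, F)
  infer_instance

end Completeness

/-! ### Bounded pointwise convergence implies Schwartz convergence -/

section Montel

variable {E F : Type*} [NormedAddCommGroup E] [NormedSpace ℝ E]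
  [NormedAddCommGroup F] [NormedSpace ℝ F] {ι : Type*} {l : Filter ι}

/-- Outside the ball of radius `|C| / ε` the decay bound suffices. Inside, a finite net does, since
the functions share the Lipschitz constant `|D|`. -/
theorem eventually_norm_le_of_tendsto_zero [FiniteDimensional ℝ E] {f : ι → 𝓢(E, F)} {C D : ℝ}
    (hC : ∀ᶠ i in l, SchwartzMap.seminorm ℝ 1 0 (f i) ≤ C)
    (hD : ∀ᶠ i in l, SchwartzMap.seminorm ℝ 0 1 (f i) ≤ D)
    (hf : ∀ z, Tendsto (fun i => f i z) l (𝓝 0)) {ε : ℝ} (hε : 0 < ε) :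
    ∀ᶠ i in l, ∀ z, ‖f i z‖ ≤ ε := by
  have : ProperSpace E := FiniteDimensional.proper ℝ E
  have hδ : 0 < ε / (2 * (|D| + 1)) := by positivity
  obtain ⟨s, -, hsf, hs⟩ := (isCompact_closedBall (0 : E) (|C| / ε)).finite_cover_balls hδ
  have h1 : ∀ᶠ i in l, ∀ w ∈ s, ‖f i w‖ < ε / 2 :=
    (hsf.eventually_all).2 fun w _ => by
      simpa using (hf w).norm.eventually_lt_const (u := ε / 2) (by simpa using half_pos hε)
  filter_upwards [hC, hD, h1] with i hCi hDi hi z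
  by_cases hz : z ∈ Metric.closedBall (0 : E) (|C| / ε)
  · obtain ⟨w, hw, hzw⟩ := mem_iUnion₂.1 (hs hz)
    have hl : ‖f i z - f i w‖ ≤ |D| * ‖z - w‖ := by
      refine Convex.norm_image_sub_le_of_norm_fderiv_le (𝕜 := ℝ) (s := univ)
        (fun x _ => (f i).differentiableAt) (fun x _ => ?_) convex_univ (mem_univ _) (mem_univ _)
      have := norm_iteratedFDeriv_le_seminorm ℝ (f i) 1 x
      rw [norm_iteratedFDeriv_one] at this
      exact this.trans (hDi.trans (le_abs_self D))
    rw [Metric.mem_ball, dist_eq_norm, lt_div_iff₀ (by positivity)] at hzw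
    have := norm_le_insert' (f i z) (f i w)
    nlinarith [hi w hw, norm_nonneg (z - w), abs_nonneg D]
  · rw [Metric.mem_closedBall, dist_zero_right, not_le, div_lt_iff₀ hε] at hz
    have h2 := norm_pow_mul_le_seminorm ℝ (f i) 1 z
    rw [pow_one] at h2
    have h3 : 0 < ‖z‖ := by
      by_contra h
      nlinarith [norm_nonneg z, abs_nonneg C, le_antisymm (not_lt.1 h) (norm_nonneg z)]
    by_contra h
    nlinarith [le_abs_self C, not_le.1 h, mul_lt_mul_of_pos_left (not_le.1 h) h3]

/-- Interpolation: a first derivative is small when the function is small and the second derivative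
is bounded, by comparing it with a difference quotient of step about `h`. -/
theorem eventually_norm_fderiv_le {f : ι → 𝓢(E, F)} {C : ℝ}
    (hC : ∀ᶠ i in l, SchwartzMap.seminorm ℝ 0 2 (f i) ≤ C)
    (hf : ∀ ε : ℝ, 0 < ε → ∀ᶠ i in l, ∀ z, ‖f i z‖ ≤ ε) {ε : ℝ} (hε : 0 < ε) :
    ∀ᶠ i in l, ∀ z, ‖fderiv ℝ (f i) z‖ ≤ ε := by
  -- The Taylor error is at most `|C| h ‖v‖ ≤ (ε / 2) ‖v‖`. On the shell `h / 2 ≤ ‖v‖ < h`, two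
  -- values of size `ε h / 8` contribute at most another `(ε / 2) ‖v‖`.
  set h : ℝ := ε / (2 * (|C| + 1)) with hh
  have hpos : 0 < h := by positivity
  have hCh : |C| * h ≤ ε / 2 := by
    rw [hh, mul_div_assoc', div_le_div_iff₀ (by positivity) two_pos]
    nlinarith [abs_nonneg C]
  filter_upwards [hC, hf (ε * h / 8) (by positivity)] with i hCi hi z
  have h2 : ∀ w, ‖fderiv ℝ (f i) w - fderiv ℝ (f i) z‖ ≤ |C| * ‖w - z‖ := fun w => by
    refine Convex.norm_image_sub_le_of_norm_fderiv_le (𝕜 := ℝ) (s := univ)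
      (fun x _ => (fderivCLM ℝ E F (f i)).differentiableAt) (fun x _ => ?_) convex_univ
      (mem_univ _) (mem_univ _)
    have := norm_iteratedFDeriv_le_seminorm ℝ (f i) 2 x
    rw [← norm_iteratedFDeriv_fderiv, norm_iteratedFDeriv_one] at this
    exact this.trans (hCi.trans (le_abs_self C))
  refine ContinuousLinearMap.opNorm_le_of_shell (ε := h) (c := (2 : ℝ)) hpos hε.le (by simp)
    fun v hv1 hv2 => ?_
  have h3 : ‖f i (z + v) - f i z - fderiv ℝ (f i) z v‖ ≤ |C| * h * ‖v‖ := by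
    have := Convex.norm_image_sub_le_of_norm_hasFDerivWithin_le' (𝕜 := ℝ) (f := f i)
      (f' := fderiv ℝ (f i)) (φ := fderiv ℝ (f i) z) (C := |C| * h) (s := Metric.ball z h)
      (fun x _ => ((f i).hasFDerivAt x).hasFDerivWithinAt)
      (fun x hx => (h2 x).trans (by
        gcongr
        rw [← dist_eq_norm]
        exact (Metric.mem_ball.1 hx).le)) (convex_ball z h)
      (Metric.mem_ball_self hpos) (y := z + v) (by simpa [Metric.mem_ball, dist_eq_norm] using hv2)
    simpa using this
  have h4 : ‖fderiv ℝ (f i) z v‖ ≤ ‖f i (z + v) - f i z - fderiv ℝ (f i) z v‖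
      + (‖f i (z + v)‖ + ‖f i z‖) := by
    have h5 := norm_sub_le (f i (z + v) - f i z) (f i (z + v) - f i z - fderiv ℝ (f i) z v)
    rw [sub_sub_cancel] at h5
    linarith [norm_sub_le (f i (z + v)) (f i z)]
  have hv1' : h / 2 ≤ ‖v‖ := by simpa using hv1
  nlinarith [hi (z + v), hi z, norm_nonneg v]

/-- Induction on the order, applied to the family of derivatives. The target then becomes `E →L[ℝ]
F`, so `F` is generalized, and `E` and `F` share a universe. -/
theorem eventually_norm_iteratedFDeriv_le {E : Type u} [NormedAddCommGroup E]
    [NormedSpace ℝ E] (n : ℕ) {F : Type u} [NormedAddCommGroup F] [NormedSpace ℝ F]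
    {f : ι → 𝓢(E, F)} (hC : ∀ n, ∃ C, ∀ᶠ i in l, SchwartzMap.seminorm ℝ 0 n (f i) ≤ C)
    (hf : ∀ ε : ℝ, 0 < ε → ∀ᶠ i in l, ∀ z, ‖f i z‖ ≤ ε) {ε : ℝ} (hε : 0 < ε) :
    ∀ᶠ i in l, ∀ z, ‖iteratedFDeriv ℝ n (f i) z‖ ≤ ε := by
  induction n generalizing F with
  | zero => simpa using hf ε hε
  | succ n ih =>
    obtain ⟨C, hC2⟩ := hC 2
    have := ih (f := fun i => fderivCLM ℝ E F (f i)) (fun m => by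
      obtain ⟨D, hD⟩ := hC (m + 1)
      refine ⟨max D 0, hD.mono fun i hi => seminorm_le_bound ℝ _ _ _ (le_max_right _ _) fun z => ?_⟩
      refine le_trans ?_ (hi.trans (le_max_left _ _))
      exact (congrArg (‖z‖ ^ 0 * ·) norm_iteratedFDeriv_fderiv).le.trans
        (le_seminorm ℝ 0 (m + 1) (f i) z))
      (fun δ hδ => eventually_norm_fderiv_le hC2 hf hδ)
    filter_upwards [this] with i hi z
    exact norm_iteratedFDeriv_fderiv.symm.le.trans (hi z)

/-- A family of Schwartz functions that is bounded in the Schwartz space and converges pointwise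
converges in the Schwartz space. -/
theorem tendsto_of_forall_tendsto_apply {E : Type u} [NormedAddCommGroup E]
    [NormedSpace ℝ E] [FiniteDimensional ℝ E] {F : Type u} [NormedAddCommGroup F] [NormedSpace ℝ F]
    {f : ι → 𝓢(E, F)} {g : 𝓢(E, F)}
    (hC : ∀ k n, ∃ C, ∀ᶠ i in l, SchwartzMap.seminorm ℝ k n (f i) ≤ C)
    (hf : ∀ z, Tendsto (fun i => f i z) l (𝓝 (g z))) : Tendsto f l (𝓝 g) := by
  have hC' : ∀ k n, ∃ C, ∀ᶠ i in l, SchwartzMap.seminorm ℝ k n (f i - g) ≤ C := fun k n => by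
    obtain ⟨C, hC⟩ := hC k n
    exact ⟨C + SchwartzMap.seminorm ℝ k n g, hC.mono fun i hi =>
      (map_sub_le_add _ _ _).trans (by gcongr)⟩
  have hsup : ∀ ε : ℝ, 0 < ε → ∀ᶠ i in l, ∀ z, ‖(f i - g) z‖ ≤ ε := fun ε hε => by
    obtain ⟨C, hC1⟩ := hC' 1 0
    obtain ⟨D, hD1⟩ := hC' 0 1
    exact eventually_norm_le_of_tendsto_zero hC1 hD1 (fun z => by
      simpa using (hf z).sub_const (g z)) hε
  refine tendsto_nhds_iff_seminorm.2 fun k n ε hε => ?_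
  obtain ⟨C, hC1⟩ := hC' (k + 1) n
  -- Inside radius `R` the weight is at most `R ^ k` and uniform smallness wins. Outside, the spare
  -- power of `‖z‖` in the seminorm of weight `k + 1` gains a factor `1 / R`.
  set R : ℝ := 2 * (|C| + 1) / ε with hR
  have hRpos : 0 < R := by positivity
  filter_upwards [hC1, eventually_norm_iteratedFDeriv_le n (hC' 0) hsup
    (show 0 < ε / 2 / R ^ k by positivity)] with i hi1 hi2
  refine lt_of_le_of_lt (seminorm_le_bound ℝ k n _ (half_pos hε).le fun z => ?_) (half_lt_self hε)
  rcases le_total ‖z‖ R with hz | hz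
  · calc _ ≤ R ^ k * (ε / 2 / R ^ k) := by
          gcongr
          exact hi2 z
      _ = ε / 2 := by field_simp
  · have h1 := (le_seminorm ℝ (k + 1) n (f i - g) z).trans (hi1.trans (le_abs_self C))
    rw [pow_succ, mul_comm (‖z‖ ^ k), mul_assoc] at h1
    have h2 : R * (‖z‖ ^ k * ‖iteratedFDeriv ℝ n (f i - g) z‖) ≤ |C| :=
      le_trans (by gcongr) h1
    have h3 : |C| ≤ R * (ε / 2) := by
      rw [hR]
      field_simp
      linarith
    exact le_of_mul_le_mul_left (h2.trans h3) hRpos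

end Montel

/-! ### Differentiation of Schwartz families in a parameter -/

section Parametric

/-- Differentiation under the integral sign, dominated by the maximum of the seminorm `(0, 1)` of
`g` on the compact interval. -/
theorem sub_eq_integral_fderivCLM {E F : Type*} [NormedAddCommGroup E] [NormedSpace ℝ E]
    [NormedAddCommGroup F] [NormedSpace ℝ F] [CompleteSpace F] {f g : ℝ → 𝓢(E, F)} {a b : ℝ}
    (hg : ContinuousOn g (uIcc a b))
    (h : ∀ z, f b z - f a z = ∫ s in a..b, g s z) (z : E) :
    fderivCLM ℝ E F (f b) z - fderivCLM ℝ E F (f a) z = ∫ s in a..b, fderivCLM ℝ E F (g s) z := by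
  obtain ⟨C, hC⟩ := isCompact_uIcc.exists_bound_of_continuousOn
    (((schwartz_withSeminorms ℝ E F).continuous_seminorm (0, 1)).comp_continuousOn hg)
  have hc : ∀ z, ContinuousOn (fun s => g s z) (uIcc a b) := fun z =>
    (continuous_apply_const z).comp_continuousOn hg
  have hc' : ∀ z, ContinuousOn (fun s => fderivCLM ℝ E F (g s) z) (uIcc a b) := fun z =>
    (continuous_apply_const z).comp_continuousOn ((fderivCLM ℝ E F).continuous.comp_continuousOn hg)
  have h1 := intervalIntegral.hasFDerivAt_integral_of_dominated_of_fderiv_le (𝕜 := ℝ)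
    (μ := volume) (F := fun z s => g s z) (F' := fun z s => fderivCLM ℝ E F (g s) z)
    (x₀ := z) (a := a) (b := b) (s := univ) (bound := fun _ => C) univ_mem
    (Eventually.of_forall fun w =>
      ((hc w).mono uIoc_subset_uIcc).aestronglyMeasurable measurableSet_uIoc)
    (hc z).intervalIntegrable
    (((hc' z).mono uIoc_subset_uIcc).aestronglyMeasurable measurableSet_uIoc)
    (Eventually.of_forall fun s hs w _ => by
      refine le_trans ?_ ((le_abs_self _).trans (hC s (uIoc_subset_uIcc hs)))
      have := norm_iteratedFDeriv_le_seminorm ℝ (g s) 1 w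
      rwa [norm_iteratedFDeriv_one] at this)
    intervalIntegrable_const
    (Eventually.of_forall fun s _ w _ => (g s).hasFDerivAt w)
  have h2 : HasFDerivAt (fun w => ∫ s in a..b, g s w)
      (fderivCLM ℝ E F (f b) z - fderivCLM ℝ E F (f a) z) z := by
    simp_rw [← h]
    exact ((f b).hasFDerivAt z).sub ((f a).hasFDerivAt z)
  exact h2.unique h1

/-- The integral identity passes to derivatives in `z`, so induction on `n` reduces everything to a
pointwise estimate of the integral. -/
theorem seminorm_sub_le_of_integral_eq {E : Type u} [NormedAddCommGroup E] [NormedSpace ℝ E]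
    (k n : ℕ) {F : Type u} [NormedAddCommGroup F] [NormedSpace ℝ F] [CompleteSpace F]
    {f g : ℝ → 𝓢(E, F)} {a b M : ℝ} (hg : ContinuousOn g (uIcc a b))
    (h : ∀ z, f b z - f a z = ∫ s in a..b, g s z)
    (hM : ∀ s ∈ uIcc a b, SchwartzMap.seminorm ℝ k n (g s) ≤ M) :
    SchwartzMap.seminorm ℝ k n (f b - f a) ≤ M * |b - a| := by
  have hM0 : 0 ≤ M := (apply_nonneg _ _).trans (hM a left_mem_uIcc)
  induction n generalizing F with
  | zero =>
    refine seminorm_le_bound ℝ _ _ _ (by positivity) fun z => ?_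
    rw [norm_iteratedFDeriv_zero, sub_apply, h z, ← norm_norm z, ← norm_pow, ← norm_smul,
      ← intervalIntegral.integral_smul]
    refine intervalIntegral.norm_integral_le_of_norm_le_const fun s hs => ?_
    rw [norm_smul, norm_pow, norm_norm]
    exact (norm_pow_mul_le_seminorm ℝ (g s) k z).trans (hM s (uIoc_subset_uIcc hs))
  | succ n ih =>
    have hle : ∀ φ : 𝓢(E, F), SchwartzMap.seminorm ℝ k n (fderivCLM ℝ E F φ) ≤
        SchwartzMap.seminorm ℝ k (n + 1) φ := fun φ =>
      seminorm_le_bound ℝ _ _ _ (apply_nonneg _ _) fun z =>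
        (congrArg (‖z‖ ^ k * ·) norm_iteratedFDeriv_fderiv).le.trans (le_seminorm ℝ k (n + 1) φ z)
    have hge : ∀ φ : 𝓢(E, F), SchwartzMap.seminorm ℝ k (n + 1) φ ≤
        SchwartzMap.seminorm ℝ k n (fderivCLM ℝ E F φ) := fun φ =>
      seminorm_le_bound ℝ _ _ _ (apply_nonneg _ _) fun z =>
        (congrArg (‖z‖ ^ k * ·) norm_iteratedFDeriv_fderiv.symm).le.trans
          (le_seminorm ℝ k n (fderivCLM ℝ E F φ) z)
    refine (hge _).trans ?_
    rw [map_sub]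
    exact ih (f := fun s => fderivCLM ℝ E F (f s)) (g := fun s => fderivCLM ℝ E F (g s))
      ((fderivCLM ℝ E F).continuous.comp_continuousOn hg) (sub_eq_integral_fderivCLM hg h)
      fun s hs => (hle _).trans (hM s hs)

/-- A family of Schwartz functions on an interval whose pointwise derivative in the parameter is a
continuous family of Schwartz functions is differentiable in the Schwartz space. -/
theorem tendsto_slope_of_hasDerivAt_apply {E : Type u} [NormedAddCommGroup E] [NormedSpace ℝ E]
    {F : Type u} [NormedAddCommGroup F] [NormedSpace ℝ F] [CompleteSpace F]
    {f g : ℝ → 𝓢(E, F)} {a b : ℝ} (hf : ContinuousOn f (Icc a b)) (hg : ContinuousOn g (Icc a b))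
    (h : ∀ z, ∀ s ∈ Ioo a b, HasDerivAt (fun s => f s z) (g s z) s) {x : ℝ} (hx : x ∈ Icc a b) :
    Tendsto (slope f x) (𝓝[Icc a b \ {x}] x) (𝓝 (g x)) := by
  have hint : ∀ u ∈ Icc a b, ∀ v ∈ Icc a b, u ≤ v → ∀ z, f v z - f u z = ∫ s in u..v, g s z := by
    intro u hu v hv huv z
    have hsub : Icc u v ⊆ Icc a b := Icc_subset_Icc hu.1 hv.2
    refine (intervalIntegral.integral_eq_sub_of_hasDerivAt_of_le huv
      ((continuous_apply_const z).comp_continuousOn (hf.mono hsub))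
      (fun s hs => h z s ⟨hu.1.trans_lt hs.1, hs.2.trans_le hv.2⟩) ?_).symm
    refine ContinuousOn.intervalIntegrable ?_
    rw [uIcc_of_le huv]
    exact (continuous_apply_const z).comp_continuousOn (hg.mono hsub)
  refine tendsto_nhds_iff_seminorm.2 fun k n ε hε => ?_
  have h1 : ∀ᶠ s in 𝓝[Icc a b] x, SchwartzMap.seminorm ℝ k n (g s - g x) < ε / 2 :=
    tendsto_nhds_iff_seminorm.1 (hg x hx) k n _ (half_pos hε)
  obtain ⟨δ, hδ, hball⟩ := Metric.mem_nhdsWithin_iff.1 h1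
  have h2 : ∀ᶠ y in 𝓝[Icc a b \ {x}] x, y ∈ Metric.ball x δ :=
    mem_nhdsWithin_of_mem_nhds (Metric.ball_mem_nhds x hδ)
  filter_upwards [h2, self_mem_nhdsWithin] with y hy hyab
  have hyx : y - x ≠ 0 := sub_ne_zero.2 hyab.2
  have hsub : uIcc x y ⊆ Icc a b := (convex_Icc a b).ordConnected.uIcc_subset hx hyab.1
  have hsub' : uIcc x y ⊆ Metric.ball x δ :=
    (convex_ball x δ).ordConnected.uIcc_subset (Metric.mem_ball_self hδ) hy
  -- Subtracting the linear family `s • g x` turns the slope into `slope f x y - g x`, whose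
  -- integrand `g s - g x` is small near `x`.
  have h3 := seminorm_sub_le_of_integral_eq k n (f := fun s => f s - s • g x)
    (g := fun s => g s - g x) (a := x) (b := y) (M := ε / 2)
    ((hg.mono hsub).sub continuousOn_const) (fun z => by
      have hi : ∀ w ∈ Icc a b, ∀ w' ∈ Icc a b,
          IntervalIntegrable (fun s => g s z) volume w w' := fun w hw w' hw' =>
        ((continuous_apply_const z).comp_continuousOn (hg.mono
          ((convex_Icc a b).ordConnected.uIcc_subset hw hw'))).intervalIntegrable
      simp only [sub_apply, smul_apply]
      rw [intervalIntegral.integral_sub (hi x hx y hyab.1) intervalIntegrable_const,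
        intervalIntegral.integral_const]
      rcases le_total x y with hxy | hxy
      · rw [← hint x hx y hyab.1 hxy z]
        module
      · rw [intervalIntegral.integral_symm, ← hint y hyab.1 x hx hxy z]
        module)
    (fun s hs => (hball ⟨hsub' hs, hsub hs⟩).le)
  have h4 : slope f x y - g x = (y - x)⁻¹ • ((f y - y • g x) - (f x - x • g x)) := by
    rw [slope_def_module]
    have : (y - x)⁻¹ • ((f y - y • g x) - (f x - x • g x)) =
      (y - x)⁻¹ • (f y - f x) - ((y - x)⁻¹ * (y - x)) • g x := by module
    rw [this, inv_mul_cancel₀ hyx, one_smul]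
  rw [h4, map_smul_eq_mul, norm_inv, Real.norm_eq_abs, inv_mul_lt_iff₀ (abs_pos.2 hyx)]
  nlinarith [abs_pos.2 hyx]

end Parametric

end SchwartzMap

/-! ### Joint continuity of evaluation, and integration over a triangle -/

/-- Joint continuity of the evaluation of pointwise convergent families of continuous linear maps
on a barrelled space, a consequence of the Banach-Steinhaus theorem. -/
theorem ContinuousLinearMap.tendsto_apply_of_barrelled {𝕜 E F ι : Type*}
    [NontriviallyNormedField 𝕜] [AddCommGroup E] [Module 𝕜 E] [UniformSpace E]
    [IsUniformAddGroup E] [ContinuousSMul 𝕜 E] [BarrelledSpace 𝕜 E] [AddCommGroup F] [Module 𝕜 F]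
    [UniformSpace F] [IsUniformAddGroup F] [ContinuousSMul 𝕜 F] [PolynormableSpace 𝕜 F]
    {l : Filter ι} [l.IsCountablyGenerated] {T : ι → E →L[𝕜] F} {T₀ : E → F} {f : ι → E} {f₀ : E}
    (hT : ∀ v, Tendsto (fun i => T i v) l (𝓝 (T₀ v))) (hf : Tendsto f l (𝓝 f₀)) :
    Tendsto (fun i => T i (f i)) l (𝓝 (T₀ f₀)) := by
  -- Banach-Steinhaus needs pointwise bounded families, and a convergent sequence, unlike a
  -- convergent filter, has bounded range.
  refine tendsto_of_seq_tendsto fun u hu => ?_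
  have heq : UniformEquicontinuous ((↑) ∘ fun n => T (u n)) :=
    PolynormableSpace.banach_steinhaus (𝕜₁ := 𝕜) fun v =>
      ((hT v).comp hu).isVonNBounded_range 𝕜
  have h1 := (hT f₀).comp hu
  have h2 : Tendsto (fun n => T (u n) (f (u n)) - T (u n) f₀) atTop (𝓝 0) := by
    have h3 : Tendsto (fun n => (T (u n) f₀, T (u n) (f (u n)))) atTop (uniformity F) := by
      intro V hV
      have h4 := (hf.comp hu).eventually (heq.equicontinuous f₀ V hV)
      exact mem_map.2 (h4.mono fun n hn => hn n)
    rw [uniformity_eq_comap_nhds_zero, tendsto_comap_iff] at h3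
    simpa [Function.comp_def] using h3
  simpa using! h2.add h1

/-- The order of integration over a triangle can be exchanged. -/
theorem intervalIntegral.integral_integral_triangle_swap {E : Type*} [NormedAddCommGroup E]
    [NormedSpace ℝ E] {f : ℝ → ℝ → E} (hf : Continuous f.uncurry) {x : ℝ} (hx : 0 ≤ x) :
    ∫ t in (0 : ℝ)..x, ∫ y in t..x, f t y = ∫ y in (0 : ℝ)..x, ∫ t in (0 : ℝ)..y, f t y := by
  -- Extend by zero from the triangle to the square, where Fubini applies.
  set D : Set (ℝ × ℝ) := {p | p.1 < p.2} with hD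
  have hDm : MeasurableSet D := measurableSet_lt measurable_fst measurable_snd
  have h := intervalIntegral_intervalIntegral_swap (a := 0) (b := x) (c := 0) (d := x)
    (F := fun t y => D.indicator f.uncurry (t, y)) (by
      refine IntegrableOn.indicator (f := f.uncurry) ?_ hDm
      exact (hf.continuousOn.integrableOn_compact (isCompact_uIcc.prod isCompact_uIcc)).mono_set
        (prod_mono uIoc_subset_uIcc uIoc_subset_uIcc))
  have h1 : ∀ t ∈ uIoc 0 x, ∫ y in (0 : ℝ)..x, D.indicator f.uncurry (t, y)
      = ∫ y in t..x, f t y := by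
    intro t ht
    rw [uIoc_of_le hx] at ht
    rw [intervalIntegral.integral_of_le hx, intervalIntegral.integral_of_le ht.2]
    have : (fun y => D.indicator f.uncurry (t, y)) = (Ioi t).indicator (f t) := by
      ext y
      simp [indicator, hD]
    rw [this, setIntegral_indicator measurableSet_Ioi]
    congr 2
    ext y
    simp only [mem_inter_iff, mem_Ioc, mem_Ioi]
    constructor
    · rintro ⟨h1, h2⟩
      exact ⟨h2, h1.2⟩
    · rintro ⟨h1, h2⟩
      exact ⟨⟨ht.1.trans h1, h2⟩, h1⟩
  have h2 : ∀ y ∈ uIoc 0 x, ∫ t in (0 : ℝ)..x, D.indicator f.uncurry (t, y)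
      = ∫ t in (0 : ℝ)..y, f t y := by
    intro y hy
    rw [uIoc_of_le hx] at hy
    rw [intervalIntegral.integral_of_le hx, intervalIntegral.integral_of_le hy.1.le]
    have : (fun t => D.indicator f.uncurry (t, y)) = (Iio y).indicator (fun t => f t y) := by
      ext t
      simp [indicator, hD]
    rw [this, setIntegral_indicator measurableSet_Iio, integral_Ioc_eq_integral_Ioo]
    congr 2
    ext t
    simp only [mem_inter_iff, mem_Ioc, mem_Iio, mem_Ioo]
    constructor
    · rintro ⟨h1, h2⟩
      exact ⟨h1.1, h2⟩
    · rintro ⟨h1, h2⟩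
      exact ⟨⟨h1, h2.le.trans hy.2⟩, h2⟩
  rw [← intervalIntegral.integral_congr_ae (ae_of_all _ h1), h,
    intervalIntegral.integral_congr_ae (ae_of_all _ h2)]

/-! ### Evolution families and Duhamel's formula -/

namespace SchwartzMap

variable {Z : Type*} [NormedAddCommGroup Z] [NormedSpace ℝ Z]

instance instPolynormableSpace : PolynormableSpace ℂ 𝓢(Z, ℂ) :=
  (schwartz_withSeminorms ℂ Z ℂ).toPolynormableSpace

theorem continuous_distribution (T : 𝓢'(Z, ℂ)) : Continuous fun φ => T φ :=
  ContinuousLinearMap.continuous ((ContinuousLinearMap.toUniformConvergenceCLM _ _ _).symm T)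

theorem distribution_map_real_smul (T : 𝓢'(Z, ℂ)) (r : ℝ) (φ : 𝓢(Z, ℂ)) :
    T (r • φ) = r • T φ := by
  rw [← Complex.coe_smul, map_smul, Complex.coe_smul]

theorem distribution_map_slope (T : 𝓢'(Z, ℂ)) (f : ℝ → 𝓢(Z, ℂ)) (x y : ℝ) :
    T (slope f x y) = slope (fun x => T (f x)) x y := by
  rw [slope_def_module, distribution_map_real_smul, map_sub, slope_def_module]

/-- `Q t x` is the evolution family of operators on the Schwartz space, dual to the equation
`u' = u ∘ A`, with generators `A x`. -/
structure IsEvolution (Q : ℝ → ℝ → 𝓢(Z, ℂ) →L[ℂ] 𝓢(Z, ℂ)) (A : ℝ → 𝓢(Z, ℂ) →L[ℂ] 𝓢(Z, ℂ)) :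
    Prop where
  apply_self : ∀ x, 0 ≤ x → ∀ φ, Q x x φ = φ
  continuousOn : ∀ φ, ContinuousOn (fun p : ℝ × ℝ => Q p.1 p.2 φ) {p | 0 ≤ p.1 ∧ p.1 ≤ p.2}
  continuousOn_generator : ∀ φ, ContinuousOn (fun x => A x φ) (Ici 0)
  tendsto_slope_right : ∀ φ t b, 0 ≤ t → ∀ x ∈ Icc t b,
    Tendsto (slope (fun x => Q t x φ) x) (𝓝[Icc t b \ {x}] x) (𝓝 (Q t x (A x φ)))
  tendsto_slope_left : ∀ φ x, ∀ t ∈ Icc 0 x,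
    Tendsto (slope (fun t => Q t x φ) t) (𝓝[Icc 0 x \ {t}] t) (𝓝 (-(A t (Q t x φ))))

/-- Duhamel's formula for the solution of `u' = u ∘ A + F`, `u 0 = G`. -/
def duhamel (Q : ℝ → ℝ → 𝓢(Z, ℂ) →L[ℂ] 𝓢(Z, ℂ)) (F : ℝ → 𝓢'(Z, ℂ)) (G : 𝓢'(Z, ℂ)) (x : ℝ)
    (φ : 𝓢(Z, ℂ)) : ℂ :=
  G (Q 0 x φ) + ∫ t in (0 : ℝ)..x, F t (Q t x φ)

theorem tendsto_distribution_apply {ι : Type*} {l : Filter ι} [l.IsCountablyGenerated]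
    {T : ι → 𝓢'(Z, ℂ)} {T₀ : 𝓢'(Z, ℂ)} {f : ι → 𝓢(Z, ℂ)} {f₀ : 𝓢(Z, ℂ)}
    (hT : Tendsto T l (𝓝 T₀)) (hf : Tendsto f l (𝓝 f₀)) :
    Tendsto (fun i => T i (f i)) l (𝓝 (T₀ f₀)) :=
  ContinuousLinearMap.tendsto_apply_of_barrelled (𝕜 := ℂ) (F := ℂ)
    (T := fun i => (ContinuousLinearMap.toUniformConvergenceCLM _ _ _).symm (T i)) (T₀ := T₀)
    (PointwiseConvergenceCLM.tendsto_iff_forall_tendsto.1 hT) hf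

namespace IsEvolution

variable {Q : ℝ → ℝ → 𝓢(Z, ℂ) →L[ℂ] 𝓢(Z, ℂ)} {A : ℝ → 𝓢(Z, ℂ) →L[ℂ] 𝓢(Z, ℂ)}
  {F : ℝ → 𝓢'(Z, ℂ)} {G : 𝓢'(Z, ℂ)}

/-- Strong continuity of `Q` is upgraded by Banach-Steinhaus to moving arguments; first countability
allows testing on sequences. -/
theorem continuous_apply (hQ : IsEvolution Q A) {X : Type*} [TopologicalSpace X]
    [FirstCountableTopology X] {τ η : X → ℝ} {ψ : X → 𝓢(Z, ℂ)} (hτ : Continuous τ)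
    (hη : Continuous η) (hψ : Continuous ψ) (h0 : ∀ p, 0 ≤ τ p) (h1 : ∀ p, τ p ≤ η p) :
    Continuous fun p => Q (τ p) (η p) (ψ p) := by
  refine continuous_iff_continuousAt.2 fun p => ?_
  refine ContinuousLinearMap.tendsto_apply_of_barrelled (𝕜 := ℂ)
    (T := fun p => Q (τ p) (η p)) (T₀ := Q (τ p) (η p)) (fun φ => ?_) hψ.continuousAt
  exact ((hQ.continuousOn φ).comp_continuous (hτ.prodMk hη)
    (fun p => ⟨h0 p, h1 p⟩)).continuousAt

theorem continuous_pairing (hQ : IsEvolution Q A) (hF : ContinuousOn F (Ici 0)) {X : Type*}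
    [TopologicalSpace X] [FirstCountableTopology X] {τ η : X → ℝ} {ψ : X → 𝓢(Z, ℂ)}
    (hτ : Continuous τ) (hη : Continuous η) (hψ : Continuous ψ) (h0 : ∀ p, 0 ≤ τ p)
    (h1 : ∀ p, τ p ≤ η p) :
    Continuous fun p => F (τ p) (Q (τ p) (η p) (ψ p)) := by
  refine continuous_iff_continuousAt.2 fun p => ?_
  exact tendsto_distribution_apply (hF.comp_continuous hτ h0).continuousAt
    (hQ.continuous_apply hτ hη hψ h0 h1).continuousAt

theorem continuous_duhamel_of (hQ : IsEvolution Q A) (hF : ContinuousOn F (Ici 0)) {X : Type*}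
    [TopologicalSpace X] [FirstCountableTopology X] {η : X → ℝ} {ψ : X → 𝓢(Z, ℂ)}
    (hη : Continuous η) (hψ : Continuous ψ) (h0 : ∀ p, 0 ≤ η p) :
    Continuous fun p => duhamel Q F G (η p) (ψ p) := by
  refine Continuous.add ((continuous_distribution G).comp
    (hQ.continuous_apply continuous_const hη hψ
    (fun _ => le_rfl) h0)) ?_
  -- The two `max` clamps extend the integrand continuously beyond `0 ≤ t ≤ η p` without changing it
  -- there.
  have h := hQ.continuous_pairing hF (X := X × ℝ) (τ := fun p => max p.2 0)
    (η := fun p => max (η p.1) (max p.2 0)) (ψ := fun p => ψ p.1) (by fun_prop) (by fun_prop)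
    (by fun_prop) (fun p => le_max_right _ _) (fun p => le_max_right _ _)
  have h2 := intervalIntegral.continuous_parametric_intervalIntegral_of_continuous (μ := volume)
    (f := fun p t => F (max t 0) (Q (max t 0) (max (η p) (max t 0)) (ψ p))) (a₀ := 0) h hη
  refine h2.congr fun p => intervalIntegral.integral_congr fun t ht => ?_
  rw [uIcc_of_le (h0 p)] at ht
  simp only [max_eq_left ht.1, max_eq_left ht.2]

theorem intervalIntegrable_pairing (hQ : IsEvolution Q A) (hF : ContinuousOn F (Ici 0)) {x : ℝ}
    (hx : 0 ≤ x) (φ : 𝓢(Z, ℂ)) : IntervalIntegrable (fun t => F t (Q t x φ)) volume 0 x := by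
  have h := hQ.continuous_pairing hF (X := ℝ) (τ := fun t => max t 0)
    (η := fun t => max x (max t 0)) (ψ := fun _ => φ) (by fun_prop) (by fun_prop)
    (by fun_prop) (fun p => le_max_right _ _) (fun p => le_max_right _ _)
  refine ContinuousOn.intervalIntegrable (h.continuousOn.congr fun t ht => ?_)
  rw [uIcc_of_le hx] at ht
  simp only [max_eq_left ht.1, max_eq_left ht.2]

/-- Duhamel's formula defines a tempered distribution. -/
theorem exists_distribution_eq_duhamel (hQ : IsEvolution Q A) (hF : ContinuousOn F (Ici 0))
    (G : 𝓢'(Z, ℂ)) {x : ℝ} (hx : 0 ≤ x) : ∃ T : 𝓢'(Z, ℂ), ∀ φ, T φ = duhamel Q F G x φ := by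
  refine ⟨ContinuousLinearMap.toUniformConvergenceCLM _ _ _
    { toFun := duhamel Q F G x
      map_add' := fun φ ψ => ?_
      map_smul' := fun c φ => ?_
      cont := hQ.continuous_duhamel_of hF continuous_const continuous_id fun _ => hx },
    fun φ => rfl⟩
  · simp only [duhamel, map_add]
    rw [intervalIntegral.integral_add (hQ.intervalIntegrable_pairing hF hx φ)
      (hQ.intervalIntegrable_pairing hF hx ψ)]
    ring
  · simp only [duhamel, map_smul, smul_eq_mul, RingHom.id_apply,
      intervalIntegral.integral_const_mul]
    ring

/-- The fundamental theorem of calculus for `y ↦ T (Q t y φ)`, whose derivative is given by the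
forward equation. -/
theorem distribution_apply_eq_add_integral (hQ : IsEvolution Q A) (T : 𝓢'(Z, ℂ)) (φ : 𝓢(Z, ℂ))
    {t x : ℝ} (ht : 0 ≤ t) (htx : t ≤ x) :
    T (Q t x φ) = T φ + ∫ y in t..x, T (Q t y (A y φ)) := by
  have hd : ∀ y ∈ Icc t x,
      HasDerivWithinAt (fun y => T (Q t y φ)) (T (Q t y (A y φ))) (Icc t x) y := by
    intro y hy
    rw [hasDerivWithinAt_iff_tendsto_slope]
    refine (((continuous_distribution T).tendsto _).comp
      (hQ.tendsto_slope_right φ t x ht y hy)).congr fun z =>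
      distribution_map_slope T _ _ _
  rw [intervalIntegral.integral_eq_sub_of_hasDerivAt_of_le htx
    (fun y hy => (hd y hy).continuousWithinAt)
    (fun y hy => (hd y (Ioo_subset_Icc_self hy)).hasDerivAt (Icc_mem_nhds hy.1 hy.2)) ?_]
  · rw [hQ.apply_self t ht]
    ring
  · have h := ((continuous_distribution T).comp (hQ.continuous_apply (X := ℝ) (τ := fun _ => t)
      (η := fun y => max y t) (ψ := fun y => A (max y t) φ) (by fun_prop) (by fun_prop)
      ((hQ.continuousOn_generator φ).comp_continuous (by fun_prop)
        fun y => ht.trans (le_max_right _ _)) (fun _ => ht) (fun _ => le_max_right _ _)))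
    refine ContinuousOn.intervalIntegrable (h.continuousOn.congr fun y hy => ?_)
    rw [uIcc_of_le htx] at hy
    simp only [Function.comp, max_eq_left hy.1]

/-- The equation in integrated form: integrate the forward equation for each `t` and exchange the
order over the triangle. It avoids differentiating an integral in which both the endpoint and the
integrand depend on `x`. -/
theorem duhamel_eq_add_integral (hQ : IsEvolution Q A) (hF : ContinuousOn F (Ici 0))
    (φ : 𝓢(Z, ℂ)) {x : ℝ} (hx : 0 ≤ x) :
    duhamel Q F G x φ = G φ + ∫ y in (0 : ℝ)..x, (F y φ + duhamel Q F G y (A y φ)) := by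
  have hcA : Continuous fun y : ℝ => A (max y 0) φ :=
    (hQ.continuousOn_generator φ).comp_continuous (by fun_prop) fun y => mem_Ici.2 (le_max_right _ _)
  have hAB : ∀ {f g : ℝ → ℂ}, Continuous f → (∀ t, 0 ≤ t → f t = g t) →
      IntervalIntegrable g volume 0 x := fun {f g} hf h =>
    ContinuousOn.intervalIntegrable (hf.continuousOn.congr fun t ht => by
      rw [uIcc_of_le hx] at ht
      exact (h t ht.1).symm)
  have hiF : IntervalIntegrable (fun t => F t φ) volume 0 x := by
    refine ContinuousOn.intervalIntegrable fun t ht => ?_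
    rw [uIcc_of_le hx] at *
    exact (PointwiseConvergenceCLM.tendsto_iff_forall_tendsto.1 (hF t ht.1) φ).mono_left
      (nhdsWithin_mono _ fun s hs => hs.1)
  set l : ℝ → ℝ → ℂ := fun t y =>
    F (max t 0) (Q (max t 0) (max y (max t 0)) (A (max y (max t 0)) φ)) with hl
  have hlc : Continuous l.uncurry := hQ.continuous_pairing hF (X := ℝ × ℝ)
    (τ := fun p => max p.1 0) (η := fun p => max p.2 (max p.1 0))
    (ψ := fun p => A (max p.2 (max p.1 0)) φ) (by fun_prop) (by fun_prop)
    ((hQ.continuousOn_generator φ).comp_continuous (by fun_prop)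
      fun p => (le_max_right p.1 0).trans (le_max_right _ _))
    (fun _ => le_max_right _ _) (fun _ => le_max_right _ _)
  have hl1 : ∀ t y, 0 ≤ t → t ≤ y → l t y = F t (Q t y (A y φ)) := fun t y ht hty => by
    simp only [hl, max_eq_left ht, max_eq_left hty]
  have h1 : ∫ t in (0 : ℝ)..x, F t (Q t x φ) =
      ∫ t in (0 : ℝ)..x, (F t φ + ∫ y in t..x, l t y) := by
    refine intervalIntegral.integral_congr fun t ht => ?_
    rw [uIcc_of_le hx] at ht
    rw [hQ.distribution_apply_eq_add_integral (F t) φ ht.1 ht.2]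
    congr 1
    refine intervalIntegral.integral_congr fun y hy => ?_
    rw [uIcc_of_le ht.2] at hy
    exact (hl1 t y ht.1 hy.1).symm
  have h2 : ∀ y ∈ uIcc 0 x, ∫ t in (0 : ℝ)..y, l t y = ∫ t in (0 : ℝ)..y, F t (Q t y (A y φ)) := by
    intro y hy
    rw [uIcc_of_le hx] at hy
    refine intervalIntegral.integral_congr fun t ht => ?_
    rw [uIcc_of_le hy.1] at ht
    exact hl1 t y ht.1 ht.2
  have hc3 : Continuous fun t => ∫ y in t..x, l t y := by
    simp_rw [intervalIntegral.integral_symm x]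
    exact (intervalIntegral.continuous_parametric_intervalIntegral_of_continuous hlc
      continuous_id).neg
  have hc4 : Continuous fun y => ∫ t in (0 : ℝ)..y, l t y :=
    intervalIntegral.continuous_parametric_intervalIntegral_of_continuous
      (f := fun y t => l t y) (hlc.comp continuous_swap) continuous_id
  have hi5 : IntervalIntegrable (fun y => G (Q 0 y (A y φ))) volume 0 x :=
    hAB (f := fun y => G (Q 0 (max y 0) (A (max y 0) φ)))
      ((continuous_distribution G).comp (hQ.continuous_apply continuous_const (by fun_prop) hcA
        (fun _ => le_rfl) fun y => le_max_right _ _))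
      (fun t ht => by simp only [max_eq_left ht])
  have hi6 : IntervalIntegrable (fun y => ∫ t in (0 : ℝ)..y, F t (Q t y (A y φ))) volume 0 x :=
    ContinuousOn.intervalIntegrable (hc4.continuousOn.congr fun y hy => (h2 y hy).symm)
  rw [duhamel, hQ.distribution_apply_eq_add_integral G φ le_rfl hx, h1,
    intervalIntegral.integral_add hiF (hc3.intervalIntegrable _ _),
    intervalIntegral.integral_integral_triangle_swap hlc hx,
    intervalIntegral.integral_congr h2]
  simp only [duhamel]
  rw [intervalIntegral.integral_add hiF (hi5.add hi6), intervalIntegral.integral_add hi5 hi6]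
  ring

theorem continuous_duhamel_generator (hQ : IsEvolution Q A) (hF : ContinuousOn F (Ici 0))
    (G : 𝓢'(Z, ℂ)) (φ : 𝓢(Z, ℂ)) : Continuous fun y : ℝ =>
      F (max y 0) φ + duhamel Q F G (max y 0) (A (max y 0) φ) := by
  refine Continuous.add ?_ (hQ.continuous_duhamel_of hF (by fun_prop)
    ((hQ.continuousOn_generator φ).comp_continuous (by fun_prop)
      fun y => mem_Ici.2 (le_max_right _ _)) fun y => le_max_right _ _)
  refine continuous_iff_continuousAt.2 fun y => ?_
  exact PointwiseConvergenceCLM.tendsto_iff_forall_tendsto.1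
    (hF.comp_continuous (f := fun y : ℝ => max y 0) (by fun_prop)
      fun y => mem_Ici.2 (le_max_right _ _)).continuousAt φ

/-- Duhamel's formula solves the equation. -/
theorem hasDerivWithinAt_duhamel (hQ : IsEvolution Q A) (hF : ContinuousOn F (Ici 0))
    (G : 𝓢'(Z, ℂ)) (φ : 𝓢(Z, ℂ)) {x : ℝ} (hx : 0 ≤ x) :
    HasDerivWithinAt (fun x => duhamel Q F G x φ) (F x φ + duhamel Q F G x (A x φ)) (Ici 0) x := by
  have hc := hQ.continuous_duhamel_generator hF G φ
  have h1 := ((hc.integral_hasStrictDerivAt 0 x).hasDerivAt.const_add (G φ)).hasDerivWithinAt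
    (s := Ici 0)
  simp only [max_eq_left hx] at h1
  refine h1.congr (fun y hy => ?_) ?_
  all_goals
    rw [hQ.duhamel_eq_add_integral hF φ (by assumption)]
    congr 1
    refine intervalIntegral.integral_congr fun s hs => ?_
    rw [uIcc_of_le (by assumption)] at hs
    simp only [max_eq_left hs.1]

/-- A solution of the equation is given by Duhamel's formula. -/
theorem eq_duhamel (hQ : IsEvolution Q A) (hF : ContinuousOn F (Ici 0))
    {W W' : ℝ → 𝓢'(Z, ℂ)}
    (hW : ∀ x, 0 ≤ x → ∀ φ, HasDerivWithinAt (fun x => W x φ) (W' x φ) (Ici 0) x)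
    (hW' : ∀ x, 0 < x → ∀ φ, W' x φ = W x (A x φ) + F x φ) {x : ℝ} (hx : 0 ≤ x) (φ : 𝓢(Z, ℂ)) :
    W x φ = duhamel Q F (W 0) x φ := by
  have hWc : ContinuousOn W (Ici 0) := fun y hy =>
    PointwiseConvergenceCLM.tendsto_iff_forall_tendsto.2 fun φ => (hW y hy φ).continuousWithinAt
  have hQc : ContinuousOn (fun t => Q t x φ) (Icc 0 x) :=
    (hQ.continuousOn φ).comp (f := fun t : ℝ => (t, x)) (by fun_prop) fun t ht => ht
  have hc : ContinuousOn (fun t => W t (Q t x φ)) (Icc 0 x) := fun t ht =>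
    tendsto_distribution_apply ((hWc t ht.1).mono fun s hs => hs.1) (hQc t ht)
  have hd : ∀ t ∈ Ioo 0 x, HasDerivAt (fun t => W t (Q t x φ)) (F t (Q t x φ)) t := by
    intro t ht
    have htI : t ∈ Icc 0 x := Ioo_subset_Icc_self ht
    refine HasDerivWithinAt.hasDerivAt (s := Icc 0 x) ?_ (Icc_mem_nhds ht.1 ht.2)
    rw [hasDerivWithinAt_iff_tendsto_slope]
    -- Product rule: the slope of `W` is paired with the moving test function, and the slope of `Q`
    -- with the fixed distribution `W t`. The two generator terms cancel, leaving `F t`.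
    have h1 : Tendsto (fun s => (slope W t s) (Q s x φ)) (𝓝[Icc 0 x \ {t}] t)
        (𝓝 (W' t (Q t x φ))) := by
      refine tendsto_distribution_apply
        (PointwiseConvergenceCLM.tendsto_iff_forall_tendsto.2 fun φ => ?_)
        ((hQc t htI).mono sdiff_subset)
      exact ((hasDerivWithinAt_iff_tendsto_slope.1 (hW t ht.1.le φ)).mono_left
        (nhdsWithin_mono _ (sdiff_subset_sdiff_left fun s hs => hs.1)))
    have h2 := ((continuous_distribution (W t)).tendsto _).comp (hQ.tendsto_slope_left φ x t htI)
    have h3 : W' t (Q t x φ) + W t (-(A t (Q t x φ))) = F t (Q t x φ) := by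
      rw [hW' t ht.1, map_neg]
      ring
    rw [← h3]
    refine (h1.add h2).congr fun s => ?_
    simp only [Function.comp, distribution_map_slope]
    simp only [slope_def_module, smul_apply, sub_apply]
    module
  have h := intervalIntegral.integral_eq_sub_of_hasDerivAt_of_le hx hc hd
    (hQ.intervalIntegrable_pairing hF hx φ)
  rw [duhamel, h, hQ.apply_self x hx]
  ring

end IsEvolution

end SchwartzMap

/-! ### Shears and the Fourier transform of the Gaussian -/

namespace PencilBeam

open scoped FourierTransform

variable {d : ℕ}

/-- The linear bijection `(ξ, η) ↦ (ξ, η - c ξ)`, the inverse of the adjoint of `shear c`. -/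
def coshear (c : ℝ) : Phase d ≃L[ℝ] Phase d :=
    { toFun := fun z => WithLp.toLp 2 (z.fst, z.snd - c • z.fst)
      invFun := fun z => WithLp.toLp 2 (z.fst, z.snd + c • z.fst)
      map_add' := fun x y => WithLp.ofLp_injective 2 (Prod.ext rfl (by
        change x.snd + y.snd - c • (x.fst + y.fst) = x.snd - c • x.fst + (y.snd - c • y.fst)
        module))
      map_smul' := fun a x => WithLp.ofLp_injective 2 (Prod.ext rfl (by
        change a • x.snd - c • a • x.fst = a • (x.snd - c • x.fst)
        module))
      left_inv := fun z => WithLp.ofLp_injective 2 (Prod.ext rfl (by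
        change z.snd - c • z.fst + c • z.fst = z.snd
        module))
      right_inv := fun z => WithLp.ofLp_injective 2 (Prod.ext rfl (by
        change z.snd + c • z.fst - c • z.fst = z.snd
        module))
      continuous_toFun := by fun_prop
      continuous_invFun := by fun_prop }

theorem coshear_fst (c : ℝ) (z : Phase d) : (coshear c z).fst = z.fst := rfl

theorem coshear_snd (c : ℝ) (z : Phase d) : (coshear c z).snd = z.snd - c • z.fst := rfl

theorem shear_fst (c : ℝ) (z : Phase d) : (shear c z).fst = z.fst + c • z.snd := rfl

theorem shear_snd (c : ℝ) (z : Phase d) : (shear c z).snd = z.snd := rfl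

theorem inner_shear_coshear (c : ℝ) (z w : Phase d) :
    inner ℝ (shear c z) (coshear c w) = inner ℝ z w := by
  rw [WithLp.prod_inner_apply, WithLp.prod_inner_apply]
  change inner ℝ (z.fst + c • z.snd) w.fst + inner ℝ z.snd (w.snd - c • w.fst) =
    inner ℝ z.fst w.fst + inner ℝ z.snd w.snd
  rw [inner_add_left, inner_sub_right, real_inner_smul_left, real_inner_smul_right]
  ring

/-- For fixed `V` the map is a translation in `X'`, so it is a skew product over the identity. -/
theorem measurePreserving_shear (c : ℝ) : MeasurePreserving (shear c : Phase d → Phase d) := by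
  have h1 : MeasurePreserving (fun p : EuclideanSpace ℝ (Fin d) × EuclideanSpace ℝ (Fin d) =>
      (p.1, c • p.1 + p.2)) (volume.prod volume) (volume.prod volume) :=
    (MeasurePreserving.id volume).skew_product (g := fun v x => c • v + x) (by fun_prop)
      (ae_of_all _ fun v => map_add_left_eq_self volume (c • v))
  have h2 := (WithLp.volume_preserving_toLp (EuclideanSpace ℝ (Fin d))
    (EuclideanSpace ℝ (Fin d))).comp ((Measure.measurePreserving_swap.comp
      (h1.comp Measure.measurePreserving_swap)).comp (WithLp.volume_preserving_ofLp
        (EuclideanSpace ℝ (Fin d)) (EuclideanSpace ℝ (Fin d))))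
  convert h2 using 1
  ext1 z
  exact WithLp.ofLp_injective 2 (Prod.ext (add_comm _ _) rfl)

theorem integral_comp_shear (c : ℝ) {E : Type*} [NormedAddCommGroup E] [NormedSpace ℝ E]
    (f : Phase d → E) : ∫ z, f (shear c z) = ∫ z, f z :=
  (measurePreserving_shear c).integral_comp
    (shear c).toHomeomorph.measurableEmbedding f

theorem fourier_comp_shear (c : ℝ) (f : Phase d → ℂ) (w : Phase d) :
    𝓕 (fun z => f (shear c z)) w = 𝓕 f (coshear c w) := by
  rw [Real.fourier_eq, Real.fourier_eq, ← integral_comp_shear c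
    (fun v => Real.fourierChar (-inner ℝ v (coshear c w)) • f v)]
  simp only [inner_shear_coshear]

theorem fourier_compCLM_shear (c : ℝ) (φ : 𝓢(Phase d, ℂ)) :
    𝓕 (SchwartzMap.compCLMOfContinuousLinearEquiv ℂ (shear c) φ) =
      SchwartzMap.compCLMOfContinuousLinearEquiv ℂ (coshear c) (𝓕 φ) := by
  ext w
  exact fourier_comp_shear c φ w

theorem fourier_product_gaussian {a b : ℝ} (ha : 0 < a) (hb : 0 < b) (w : Phase d) :
    𝓕 (fun z : Phase d => (Real.exp (-(a * ‖z.fst‖ ^ 2 + b * ‖z.snd‖ ^ 2)) : ℂ)) w =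
      (((Real.pi / a) ^ (d / 2 : ℝ) * (Real.pi / b) ^ (d / 2 : ℝ) : ℝ) : ℂ) *
        (Real.exp (-(Real.pi ^ 2 * (‖w.fst‖ ^ 2 / a + ‖w.snd‖ ^ 2 / b))) : ℂ) := by
  have h1 : ∀ {a : ℝ}, 0 < a → ∀ w : EuclideanSpace ℝ (Fin d),
      ∫ v : EuclideanSpace ℝ (Fin d), Real.fourierChar (-inner ℝ v w) •
        Complex.exp (-(a : ℂ) * (‖v‖ : ℂ) ^ 2) =
      (((Real.pi / a) ^ (d / 2 : ℝ) : ℝ) : ℂ) * (Real.exp (-(Real.pi ^ 2 * (‖w‖ ^ 2 / a))) : ℂ) := by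
    intro a ha w
    have := fourier_gaussian_innerProductSpace (b := (a : ℂ)) (by simpa using ha) w
    rw [Real.fourier_eq] at this
    rw [this, finrank_euclideanSpace_fin, Complex.ofReal_cpow (by positivity)]
    push_cast
    congr 2
    ring
  rw [Real.fourier_eq, ← (WithLp.volume_preserving_symm_measurableEquiv_toLp_prod
    (EuclideanSpace ℝ (Fin d)) (EuclideanSpace ℝ (Fin d))).symm.integral_comp']
  have h2 : ∀ p : EuclideanSpace ℝ (Fin d) × EuclideanSpace ℝ (Fin d),
      Real.fourierChar (-inner ℝ (WithLp.toLp 2 p : Phase d) w) •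
        (Real.exp (-(a * ‖p.1‖ ^ 2 + b * ‖p.2‖ ^ 2)) : ℂ) =
      (Real.fourierChar (-inner ℝ p.1 w.fst) • Complex.exp (-(a : ℂ) * (‖p.1‖ : ℂ) ^ 2)) *
      (Real.fourierChar (-inner ℝ p.2 w.snd) • Complex.exp (-(b : ℂ) * (‖p.2‖ : ℂ) ^ 2)) := by
    intro p
    rw [WithLp.prod_inner_apply]
    change Real.fourierChar (-(inner ℝ p.1 w.fst + inner ℝ p.2 w.snd)) • _ = _
    rw [neg_add, AddChar.map_add_eq_mul, smul_mul_smul_comm, ← Complex.exp_add]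
    push_cast
    congr 2
    ring
  refine (integral_congr_ae (ae_of_all _ h2)).trans ?_
  rw [Measure.volume_eq_prod]
  rw [integral_prod_mul (fun v => Real.fourierChar (-inner ℝ v w.fst) •
    Complex.exp (-(a : ℂ) * (‖v‖ : ℂ) ^ 2)) (fun v => Real.fourierChar (-inner ℝ v w.snd) •
    Complex.exp (-(b : ℂ) * (‖v‖ : ℂ) ^ 2)), h1 ha, h1 hb]
  rw [mul_mul_mul_comm, ← Complex.ofReal_mul, ← Complex.ofReal_mul, ← Real.exp_add]
  congr 3
  ring

/-- The quadratic form `E₀ |η|² - 2 E₁ ξ · η + E₂ |ξ|²`. -/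
def momentForm (E₀ E₁ E₂ : ℝ) (w : Phase d) : ℝ :=
  E₀ * ‖w.snd‖ ^ 2 - 2 * E₁ * inner ℝ w.fst w.snd + E₂ * ‖w.fst‖ ^ 2

/-- The Fourier transform of the Gaussian with moments `E₀, E₁, E₂`. -/
def symbol (E₀ E₁ E₂ : ℝ) (w : Phase d) : ℝ :=
  Real.exp (-(4 * Real.pi ^ 2 * momentForm E₀ E₁ E₂ w))

/-- Completing the square in `X'`: the shear by `E₁ / E₀` removes the mixed term and leaves a
product of Gaussians in `X'` and `V`. -/
theorem gaussian_eq_comp_shear {E₀ E₁ E₂ : ℝ} (h₀ : 0 < E₀) (hΔ : 0 < E₂ * E₀ - E₁ ^ 2)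
    (z : Phase d) :
    gaussian E₀ E₁ E₂ z = ((4 * Real.pi * √(E₂ * E₀ - E₁ ^ 2)) ^ d)⁻¹ *
      Real.exp (-(E₀ / (4 * (E₂ * E₀ - E₁ ^ 2)) * ‖(shear (E₁ / E₀) z).fst‖ ^ 2 +
        1 / (4 * E₀) * ‖(shear (E₁ / E₀) z).snd‖ ^ 2)) := by
  rw [gaussian, div_eq_inv_mul, shear_fst, shear_snd, norm_add_sq_real, norm_smul,
    real_inner_smul_right, mul_pow ‖E₁ / E₀‖, Real.norm_eq_abs, sq_abs]
  congr 3
  have h1 : E₂ * E₀ - E₁ ^ 2 ≠ 0 := hΔ.ne'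
  field_simp
  ring

theorem fourier_gaussianKernel {E₀ E₁ E₂ : ℝ} (h₀ : 0 < E₀) (hΔ : 0 < E₂ * E₀ - E₁ ^ 2)
    (w : Phase d) : 𝓕 (gaussianKernel d E₀ E₁ E₂) w = (symbol E₀ E₁ E₂ w : ℂ) := by
  set Δ := E₂ * E₀ - E₁ ^ 2 with hΔ_def
  have h1 : (gaussianKernel d E₀ E₁ E₂ : Phase d → ℂ) =
      (((4 * Real.pi * √Δ) ^ d)⁻¹ : ℝ) • (fun z : Phase d => (fun z : Phase d =>
        (Real.exp (-(E₀ / (4 * Δ) * ‖z.fst‖ ^ 2 + 1 / (4 * E₀) * ‖z.snd‖ ^ 2)) : ℂ))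
          (shear (E₁ / E₀) z)) := by
    ext z
    rw [gaussianKernel_apply h₀ hΔ, gaussian_eq_comp_shear h₀ hΔ, Pi.smul_apply, Complex.real_smul,
      Complex.ofReal_mul]
  -- The widths multiply to `(4π √Δ)²`, so the normalization in `gaussian` is exactly the one giving
  -- total mass one.
  have hconst : ((4 * Real.pi * √Δ) ^ d)⁻¹ * ((Real.pi / (E₀ / (4 * Δ))) ^ (d / 2 : ℝ) *
      (Real.pi / (1 / (4 * E₀))) ^ (d / 2 : ℝ)) = 1 := by
    rw [← Real.mul_rpow (by positivity) (by positivity)]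
    have : Real.pi / (E₀ / (4 * Δ)) * (Real.pi / (1 / (4 * E₀))) = (4 * Real.pi * √Δ) ^ 2 := by
      rw [mul_pow, Real.sq_sqrt hΔ.le]
      field_simp
    rw [this, ← Real.rpow_natCast _ 2, ← Real.rpow_mul (by positivity)]
    rw [show ((2 : ℕ) : ℝ) * (d / 2 : ℝ) = d by push_cast; ring, Real.rpow_natCast]
    exact inv_mul_cancel₀ (by positivity)
  rw [SchwartzMap.fourier_coe, h1, Real.fourier_eq]
  simp only [Pi.smul_apply, smul_comm _ (((4 * Real.pi * √Δ) ^ d)⁻¹ : ℝ)]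
  rw [integral_smul, ← Real.fourier_eq, fourier_comp_shear (E₁ / E₀) (fun z : Phase d =>
        (Real.exp (-(E₀ / (4 * Δ) * ‖z.fst‖ ^ 2 + 1 / (4 * E₀) * ‖z.snd‖ ^ 2)) : ℂ)),
    fourier_product_gaussian
    (by positivity) (by positivity), Complex.real_smul, ← mul_assoc, ← Complex.ofReal_mul, hconst,
    Complex.ofReal_one, one_mul, symbol, coshear_fst, coshear_snd, norm_sub_sq_real, norm_smul,
    real_inner_smul_right, mul_pow ‖E₁ / E₀‖, Real.norm_eq_abs, sq_abs, momentForm,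
    real_inner_comm w.fst w.snd]
  congr 3
  field_simp
  rw [hΔ_def]
  ring

/-- The Gaussian is even, so the reflection in the dual definition of `conv` has no effect. -/
theorem gaussianKernel_comp_neg {E₀ E₁ E₂ : ℝ} (h₀ : 0 < E₀) (hΔ : 0 < E₂ * E₀ - E₁ ^ 2) :
    SchwartzMap.compCLMOfContinuousLinearEquiv ℂ (ContinuousLinearEquiv.neg ℝ)
      (gaussianKernel d E₀ E₁ E₂) = gaussianKernel d E₀ E₁ E₂ := by
  ext z
  change gaussianKernel d E₀ E₁ E₂ (-z) = _
  rw [gaussianKernel_apply h₀ hΔ, gaussianKernel_apply h₀ hΔ]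
  congr 1
  simp only [gaussian, WithLp.neg_fst, WithLp.neg_snd, norm_neg, inner_neg_neg]

end PencilBeam

/-! ### Seminorm bounds for multiplication and linear substitution -/

section Bounds

open scoped Nat

variable {E : Type*} [NormedAddCommGroup E] [NormedSpace ℝ E]

theorem norm_iteratedFDeriv_ofReal_comp {f : E → ℝ} {n : ℕ} (hf : ContDiff ℝ n f) (z : E) :
    ‖iteratedFDeriv ℝ n (fun z => (f z : ℂ)) z‖ = ‖iteratedFDeriv ℝ n f z‖ :=
  Complex.ofRealLI.norm_iteratedFDeriv_comp_left hf.contDiffAt le_rfl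

/-- The derivatives of `exp (-q)`, for `q ≥ 0`, are bounded in terms of those of `q`. -/
theorem norm_iteratedFDeriv_exp_neg_le {q : E → ℝ} (hq : ContDiff ℝ (⊤ : ℕ∞) q) {n l : ℕ} {C : ℝ}
    (hC : 0 ≤ C) (hgr : ∀ m ≤ n, ∀ z, ‖iteratedFDeriv ℝ m q z‖ ≤ C * (1 + ‖z‖) ^ l)
    (h0 : ∀ z, 0 ≤ q z) {m : ℕ} (hm : m ≤ n) (z : E) :
    ‖iteratedFDeriv ℝ m (fun z => Real.exp (-q z)) z‖ ≤
      n ! * (C + 1) ^ n * (1 + ‖z‖) ^ (l * n) := by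
  have hp : (1 : ℝ) ≤ (1 + ‖z‖) ^ l := one_le_pow₀ (by simp)
  have hA : (1 : ℝ) ≤ (C + 1) * (1 + ‖z‖) ^ l := by nlinarith
  have h1 := norm_iteratedFDeriv_comp_le (n := m) (N := (⊤ : ℕ∞)) (C := 1)
    (D := (C + 1) * (1 + ‖z‖) ^ l) Real.contDiff_exp hq.neg (mod_cast le_top) z
    (fun i _ => by
      rw [norm_iteratedFDeriv_eq_norm_iteratedDeriv, iteratedDeriv_eq_iterate,
        Real.iter_deriv_exp, Real.norm_eq_abs, abs_of_pos (Real.exp_pos _)]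
      exact Real.exp_le_one_iff.2 (neg_nonpos.2 (h0 z)))
    (fun i hi1 hi => by
      change ‖iteratedFDeriv ℝ i (-q) z‖ ≤ _
      rw [iteratedFDeriv_neg_apply, norm_neg]
      refine (hgr i (hi.trans hm) z).trans ?_
      calc C * (1 + ‖z‖) ^ l ≤ (C + 1) * (1 + ‖z‖) ^ l := by gcongr; simp
        _ ≤ _ := le_self_pow₀ hA (by omega))
  refine h1.trans ?_
  rw [mul_one]
  calc (m ! : ℝ) * ((C + 1) * (1 + ‖z‖) ^ l) ^ m ≤ n ! * ((C + 1) * (1 + ‖z‖) ^ l) ^ n := by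
        gcongr
    _ = _ := by rw [mul_pow, pow_mul, mul_assoc]

namespace SchwartzMap

/-- Multiplication by functions with uniform temperate growth is uniformly bounded. -/
theorem exists_seminorm_smulLeftCLM_le (k n r : ℕ) {B : ℝ} (hB : 0 ≤ B) (ψ : 𝓢(E, ℂ)) :
    ∃ C, ∀ f : E → ℂ, f.HasTemperateGrowth →
      (∀ m ≤ n, ∀ z, ‖iteratedFDeriv ℝ m f z‖ ≤ B * (1 + ‖z‖) ^ r) →
      SchwartzMap.seminorm ℝ k n (smulLeftCLM ℂ f ψ) ≤ C := by
  set S := (Finset.Iic (k + r, n)).sup (fun m => SchwartzMap.seminorm ℝ m.1 m.2) ψ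
  have hS : 0 ≤ S := apply_nonneg _ _
  refine ⟨2 ^ n * (B * (2 ^ (k + r) * S)), fun f hf hfb =>
    seminorm_le_bound ℝ _ _ _ (by positivity) fun z => ?_⟩
  have h1 : (smulLeftCLM ℂ f ψ : E → ℂ) = fun z => f z • ψ z :=
    funext fun z => smulLeftCLM_apply_apply hf ψ z
  have h2 := norm_iteratedFDeriv_smul_le (n := n) (N := (⊤ : ℕ∞)) hf.1 (ψ.smooth ⊤) z
    (mod_cast le_top)
  rw [h1]
  calc _ ≤ (1 + ‖z‖) ^ k * ∑ i ∈ Finset.range (n + 1), (n.choose i : ℝ) *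
        ‖iteratedFDeriv ℝ i f z‖ * ‖iteratedFDeriv ℝ (n - i) ψ z‖ := by
        gcongr
        · simp
    _ ≤ ∑ i ∈ Finset.range (n + 1), (n.choose i : ℝ) * (B * (2 ^ (k + r) * S)) := by
        rw [Finset.mul_sum]
        refine Finset.sum_le_sum fun i hi => ?_
        have h3 := one_add_le_sup_seminorm_apply (𝕜 := ℝ) (m := (k + r, n)) (k := k + r)
          (n := n - i) le_rfl (Nat.sub_le _ _) ψ z
        have h4 := hfb i (Nat.lt_succ_iff.1 (Finset.mem_range.1 hi)) z
        calc _ ≤ (1 + ‖z‖) ^ k * ((n.choose i : ℝ) * (B * (1 + ‖z‖) ^ r) *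
              ‖iteratedFDeriv ℝ (n - i) ψ z‖) := by gcongr
          _ = (n.choose i : ℝ) * (B * ((1 + ‖z‖) ^ (k + r) *
              ‖iteratedFDeriv ℝ (n - i) ψ z‖)) := by ring
          _ ≤ _ := by gcongr
    _ = _ := by
        rw [← Finset.sum_mul]
        congr 1
        exact_mod_cast Nat.sum_range_choose n

theorem seminorm_compCLM_le (k n : ℕ) {g : E ≃L[ℝ] E} {M : ℝ} (hM : 0 ≤ M)
    (h1 : ∀ z, ‖g z‖ ≤ M * ‖z‖) (h2 : ∀ z, ‖z‖ ≤ M * ‖g z‖) (ψ : 𝓢(E, ℂ)) :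
    SchwartzMap.seminorm ℝ k n (compCLMOfContinuousLinearEquiv ℂ g ψ) ≤
      M ^ k * M ^ n * SchwartzMap.seminorm ℝ k n ψ := by
  refine seminorm_le_bound ℝ _ _ _ (by positivity) fun z => ?_
  have h3 : iteratedFDeriv ℝ n (compCLMOfContinuousLinearEquiv ℂ g ψ) z =
      (iteratedFDeriv ℝ n ψ (g z)).compContinuousLinearMap fun _ => (g : E →L[ℝ] E) :=
    (g : E →L[ℝ] E).iteratedFDeriv_comp_right (ψ.smooth ⊤) z (mod_cast le_top)
  have hg : ‖(g : E →L[ℝ] E)‖ ≤ M := ContinuousLinearMap.opNorm_le_bound _ hM h1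
  have h4 : ‖iteratedFDeriv ℝ n (compCLMOfContinuousLinearEquiv ℂ g ψ) z‖ ≤
      ‖iteratedFDeriv ℝ n ψ (g z)‖ * M ^ n := by
    rw [h3]
    refine (ContinuousMultilinearMap.norm_compContinuousLinearMap_le _ _).trans ?_
    rw [Finset.prod_const, Finset.card_univ, Fintype.card_fin]
    gcongr
  calc _ ≤ (M * ‖g z‖) ^ k * (‖iteratedFDeriv ℝ n ψ (g z)‖ * M ^ n) := by
        gcongr
        exact h2 z
    _ = M ^ k * M ^ n * (‖g z‖ ^ k * ‖iteratedFDeriv ℝ n ψ (g z)‖) := by ring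
    _ ≤ _ := by
        gcongr
        exact le_seminorm ℝ k n ψ (g z)

end SchwartzMap

end Bounds

/-! ### Continuity of shears and Gaussian multipliers in their parameters -/

namespace PencilBeam

variable {d : ℕ}

theorem coshear_neg_coshear (c : ℝ) (z : Phase d) : coshear (-c) (coshear c z) = z :=
  WithLp.ofLp_injective 2 (Prod.ext rfl (by
    change z.snd - c • z.fst - (-c) • z.fst = z.snd
    module))

theorem norm_coshear_le (c : ℝ) (z : Phase d) : ‖coshear c z‖ ≤ (1 + |c|) * ‖z‖ := by
  have h1 : coshear c z = z - c • (WithLp.toLp 2 (0, z.fst) : Phase d) :=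
    WithLp.ofLp_injective 2 (Prod.ext (by
      change z.fst = z.fst - c • (0 : EuclideanSpace ℝ (Fin d))
      simp) rfl)
  have h2 : ‖(WithLp.toLp 2 (0, z.fst) : Phase d)‖ ≤ ‖z‖ := by
    rw [← sq_le_sq₀ (norm_nonneg _) (norm_nonneg _), WithLp.prod_norm_sq_eq_of_L2,
      WithLp.prod_norm_sq_eq_of_L2]
    change ‖(0 : EuclideanSpace ℝ (Fin d))‖ ^ 2 + ‖z.fst‖ ^ 2 ≤ _
    rw [norm_zero]
    nlinarith [sq_nonneg ‖z.snd‖]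
  rw [h1]
  refine (norm_sub_le _ _).trans ?_
  rw [norm_smul, Real.norm_eq_abs]
  nlinarith [mul_le_mul_of_nonneg_left h2 (abs_nonneg c)]

theorem continuous_coshear_apply (z : Phase d) : Continuous fun c : ℝ => coshear c z := by
  have : ∀ c : ℝ, coshear c z = z - c • (WithLp.toLp 2 (0, z.fst) : Phase d) := fun c =>
    WithLp.ofLp_injective 2 (Prod.ext (by
      change z.fst = z.fst - c • (0 : EuclideanSpace ℝ (Fin d))
      simp) rfl)
  simp only [this]
  fun_prop

/-- For `c` within distance one of `c₀`, both `coshear c` and its inverse `coshear (-c)` have norm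
at most `2 + |c₀|`. The family is therefore bounded in the Schwartz space, and pointwise convergence
suffices. -/
theorem continuous_compCLM_coshear (ψ : 𝓢(Phase d, ℂ)) :
    Continuous fun c : ℝ => SchwartzMap.compCLMOfContinuousLinearEquiv ℂ (coshear c) ψ := by
  refine continuous_iff_continuousAt.2 fun c₀ => ?_
  refine SchwartzMap.tendsto_of_forall_tendsto_apply (fun k n => ?_) fun z => ?_
  · refine ⟨(2 + |c₀|) ^ k * (2 + |c₀|) ^ n * SchwartzMap.seminorm ℝ k n ψ, ?_⟩
    filter_upwards [Metric.ball_mem_nhds c₀ one_pos] with c hc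
    have hc' : |c| ≤ 1 + |c₀| := by
      have := abs_sub_abs_le_abs_sub c c₀
      rw [Metric.mem_ball, Real.dist_eq] at hc
      linarith
    refine SchwartzMap.seminorm_compCLM_le k n (by positivity) (fun z => ?_) (fun z => ?_) ψ
    · refine (norm_coshear_le c z).trans ?_
      exact mul_le_mul_of_nonneg_right (by linarith) (norm_nonneg _)
    · have := norm_coshear_le (-c) (coshear c z)
      rw [coshear_neg_coshear, abs_neg] at this
      refine this.trans ?_
      exact mul_le_mul_of_nonneg_right (by linarith) (norm_nonneg _)
  · exact (ψ.continuous.comp (continuous_coshear_apply z)).continuousAt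

theorem hasTemperateGrowth_momentForm_basis :
    (fun w : Phase d => ‖w.snd‖ ^ 2).HasTemperateGrowth ∧
      (fun w : Phase d => inner ℝ w.fst w.snd).HasTemperateGrowth ∧
      (fun w : Phase d => ‖w.fst‖ ^ 2).HasTemperateGrowth := by
  have hfst : (fun z : Phase d => z.fst).HasTemperateGrowth :=
    (WithLp.fstL 2 ℝ (EuclideanSpace ℝ (Fin d)) (EuclideanSpace ℝ (Fin d))).hasTemperateGrowth
  have hsnd : (fun z : Phase d => z.snd).HasTemperateGrowth :=
    (WithLp.sndL 2 ℝ (EuclideanSpace ℝ (Fin d)) (EuclideanSpace ℝ (Fin d))).hasTemperateGrowth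
  have hsq := Function.hasTemperateGrowth_norm_sq (H := EuclideanSpace ℝ (Fin d))
  refine ⟨hsq.comp hsnd, ?_, hsq.comp hfst⟩
  exact (innerSL ℝ (E := EuclideanSpace ℝ (Fin d))).bilinear_hasTemperateGrowth hfst hsnd

theorem hasTemperateGrowth_momentForm (E₀ E₁ E₂ : ℝ) :
    (momentForm E₀ E₁ E₂ : Phase d → ℝ).HasTemperateGrowth := by
  obtain ⟨h0, h1, h2⟩ := hasTemperateGrowth_momentForm_basis (d := d)
  exact (((Function.HasTemperateGrowth.const E₀).mul h0).sub
    ((Function.HasTemperateGrowth.const (2 * E₁)).mul h1)).add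
    ((Function.HasTemperateGrowth.const E₂).mul h2)

/-- The form is a combination of three fixed functions of temperate growth, with coefficients
bounded in terms of `M`. -/
theorem exists_norm_iteratedFDeriv_momentForm_le (n : ℕ) (M : ℝ) : ∃ (l : ℕ) (C : ℝ), 0 ≤ C ∧
    ∀ E₀ E₁ E₂ : ℝ, |E₀| ≤ M → |E₁| ≤ M → |E₂| ≤ M → ∀ m ≤ n, ∀ z : Phase d,
      ‖iteratedFDeriv ℝ m (momentForm E₀ E₁ E₂) z‖ ≤ C * (1 + ‖z‖) ^ l := by
  obtain ⟨h0, h1, h2⟩ := hasTemperateGrowth_momentForm_basis (d := d)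
  obtain ⟨l0, C0, hC0, hb0⟩ := h0.norm_iteratedFDeriv_le_uniform n
  obtain ⟨l1, C1, hC1, hb1⟩ := h1.norm_iteratedFDeriv_le_uniform n
  obtain ⟨l2, C2, hC2, hb2⟩ := h2.norm_iteratedFDeriv_le_uniform n
  refine ⟨l0 + l1 + l2, |M| * C0 + 2 * |M| * C1 + |M| * C2, by positivity,
    fun E₀ E₁ E₂ hE₀ hE₁ hE₂ m hm z => ?_⟩
  have hc : ∀ {f : Phase d → ℝ}, f.HasTemperateGrowth → ContDiffAt ℝ m f z := fun hf =>
    (hf.1.of_le (mod_cast le_top)).contDiffAt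
  have heq : (momentForm E₀ E₁ E₂ : Phase d → ℝ) = E₀ • (fun w : Phase d => ‖w.snd‖ ^ 2) -
      (2 * E₁) • (fun w : Phase d => inner ℝ w.fst w.snd) +
        E₂ • (fun w : Phase d => ‖w.fst‖ ^ 2) := rfl
  have hc0 : ContDiffAt ℝ m (E₀ • fun w : Phase d => ‖w.snd‖ ^ 2) z := (hc h0).const_smul E₀
  have hc1 : ContDiffAt ℝ m ((2 * E₁) • fun w : Phase d => (inner ℝ w.fst w.snd : ℝ)) z :=
    (hc h1).const_smul (2 * E₁)
  have hc2 : ContDiffAt ℝ m (E₂ • fun w : Phase d => ‖w.fst‖ ^ 2) z := (hc h2).const_smul E₂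
  have hc01 : ContDiffAt ℝ m (E₀ • (fun w : Phase d => ‖w.snd‖ ^ 2) -
      (2 * E₁) • fun w : Phase d => (inner ℝ w.fst w.snd : ℝ)) z := hc0.sub hc1
  rw [heq, iteratedFDeriv_add_apply hc01 hc2, iteratedFDeriv_sub_apply hc0 hc1,
    iteratedFDeriv_const_smul_apply (hc h0), iteratedFDeriv_const_smul_apply (hc h1),
    iteratedFDeriv_const_smul_apply (hc h2)]
  have hz : (1 : ℝ) ≤ 1 + ‖z‖ := by simp
  have hM := le_abs_self M
  have hpow : ∀ {l : ℕ}, l ≤ l0 + l1 + l2 → (1 + ‖z‖) ^ l ≤ (1 + ‖z‖) ^ (l0 + l1 + l2) :=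
    fun h => pow_le_pow_right₀ hz h
  refine (norm_add_le _ _).trans ((add_le_add_left (norm_sub_le _ _) _).trans ?_)
  simp only [norm_smul, norm_mul, Real.norm_eq_abs, Nat.abs_ofNat]
  calc _ ≤ |M| * (C0 * (1 + ‖z‖) ^ (l0 + l1 + l2)) + 2 * |M| * (C1 * (1 + ‖z‖) ^ (l0 + l1 + l2)) +
        |M| * (C2 * (1 + ‖z‖) ^ (l0 + l1 + l2)) := by
        have hb : ∀ {D b : ℝ} {l : ℕ}, 0 ≤ b → l ≤ l0 + l1 + l2 → D ≤ b * (1 + ‖z‖) ^ l →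
            D ≤ b * (1 + ‖z‖) ^ (l0 + l1 + l2) := fun hb hl h =>
          h.trans (mul_le_mul_of_nonneg_left (hpow hl) hb)
        refine add_le_add (add_le_add ?_ ?_) ?_
        · exact mul_le_mul (hE₀.trans hM) (hb hC0 (by omega) (hb0 m hm z)) (norm_nonneg _)
            (abs_nonneg _)
        · exact mul_le_mul (mul_le_mul_of_nonneg_left (hE₁.trans hM) zero_le_two)
            (hb hC1 (by omega) (hb1 m hm z)) (norm_nonneg _) (by positivity)
        · exact mul_le_mul (hE₂.trans hM) (hb hC2 (by omega) (hb2 m hm z)) (norm_nonneg _)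
            (abs_nonneg _)
    _ = _ := by ring

/-- Only nonnegativity of the form is needed, so the bound stays uniform up to the degenerate case
`t = x`, where no Gaussian kernel exists. -/
theorem exists_norm_iteratedFDeriv_symbol_le (n : ℕ) (M : ℝ) : ∃ (r : ℕ) (B : ℝ), 0 ≤ B ∧
    ∀ E₀ E₁ E₂ : ℝ, |E₀| ≤ M → |E₁| ≤ M → |E₂| ≤ M → (∀ w : Phase d, 0 ≤ momentForm E₀ E₁ E₂ w) →
      ∀ m ≤ n, ∀ z : Phase d,
      ‖iteratedFDeriv ℝ m (fun w => (symbol E₀ E₁ E₂ w : ℂ)) z‖ ≤ B * (1 + ‖z‖) ^ r := by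
  obtain ⟨l, C, hC, h⟩ := exists_norm_iteratedFDeriv_momentForm_le (d := d) n M
  obtain ⟨κ, hκ, hκ0⟩ : ∃ κ : ℝ, κ = 4 * Real.pi ^ 2 ∧ 0 ≤ κ := ⟨_, rfl, by positivity⟩
  have hsym : ∀ E₀ E₁ E₂, (symbol E₀ E₁ E₂ : Phase d → ℝ) =
      fun w => Real.exp (-(κ * momentForm E₀ E₁ E₂ w)) := by
    intro E₀ E₁ E₂
    rw [hκ]
    rfl
  refine ⟨l * n, n.factorial * (κ * C + 1) ^ n, by positivity,
    fun E₀ E₁ E₂ h0 h1 h2 hpos m hm z => ?_⟩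
  have hs : ContDiff ℝ (⊤ : ℕ∞) (momentForm E₀ E₁ E₂ : Phase d → ℝ) :=
    (hasTemperateGrowth_momentForm E₀ E₁ E₂).1
  have hs2 : ContDiff ℝ (⊤ : ℕ∞) (fun w : Phase d => κ * momentForm E₀ E₁ E₂ w) :=
    contDiff_const.mul hs
  have hs3 : ContDiff ℝ m (symbol E₀ E₁ E₂ : Phase d → ℝ) := by
    rw [hsym]
    exact (Real.contDiff_exp.comp hs2.neg).of_le (mod_cast le_top)
  rw [norm_iteratedFDeriv_ofReal_comp hs3, hsym]
  refine norm_iteratedFDeriv_exp_neg_le hs2 (by positivity) (fun i hi w => ?_)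
    (fun w => mul_nonneg hκ0 (hpos w)) hm z
  change ‖iteratedFDeriv ℝ i (κ • momentForm E₀ E₁ E₂ : Phase d → ℝ) w‖ ≤ _
  rw [iteratedFDeriv_const_smul_apply ((hs.of_le (mod_cast le_top)).contDiffAt), norm_smul,
    Real.norm_eq_abs, abs_of_nonneg hκ0, mul_assoc]
  gcongr
  exact h E₀ E₁ E₂ h0 h1 h2 i hi w

theorem hasTemperateGrowth_symbol {E₀ E₁ E₂ : ℝ} (hpos : ∀ w : Phase d, 0 ≤ momentForm E₀ E₁ E₂ w) :
    (fun w : Phase d => (symbol E₀ E₁ E₂ w : ℂ)).HasTemperateGrowth := by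
  refine ⟨?_, fun n => ?_⟩
  · exact Complex.ofRealCLM.contDiff.comp (Real.contDiff_exp.comp (ContDiff.neg
      (contDiff_const.mul (hasTemperateGrowth_momentForm E₀ E₁ E₂).1)))
  · obtain ⟨r, B, -, h⟩ := exists_norm_iteratedFDeriv_symbol_le (d := d) n
      (max (max |E₀| |E₁|) |E₂|)
    exact ⟨r, B, fun z => h E₀ E₁ E₂ (by simp) (by simp) (by simp) hpos n le_rfl z⟩

/-- Multiplication by the symbols of nonnegative forms depends continuously on the moments. -/
theorem continuousOn_smulLeftCLM_symbol {X : Type*} [TopologicalSpace X] {s : Set X}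
    {E₀ E₁ E₂ : X → ℝ} (h₀ : ContinuousOn E₀ s) (h₁ : ContinuousOn E₁ s) (h₂ : ContinuousOn E₂ s)
    (hpos : ∀ p ∈ s, ∀ w : Phase d, 0 ≤ momentForm (E₀ p) (E₁ p) (E₂ p) w) (ψ : 𝓢(Phase d, ℂ)) :
    ContinuousOn (fun p => SchwartzMap.smulLeftCLM ℂ
      (fun w : Phase d => (symbol (E₀ p) (E₁ p) (E₂ p) w : ℂ)) ψ) s := by
  intro p hp
  refine SchwartzMap.tendsto_of_forall_tendsto_apply (fun k n => ?_) fun z => ?_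
  · obtain ⟨r, B, hB, h⟩ := exists_norm_iteratedFDeriv_symbol_le (d := d) n
      (|E₀ p| + |E₁ p| + |E₂ p| + 1)
    obtain ⟨C, hC⟩ := SchwartzMap.exists_seminorm_smulLeftCLM_le k n r hB ψ
    refine ⟨C, ?_⟩
    have hb : ∀ {f : X → ℝ}, ContinuousOn f s → ∀ᶠ q in 𝓝[s] p, |f q| < |f p| + 1 := fun hf =>
      (hf p hp).abs.eventually_lt_const (lt_add_one _)
    filter_upwards [hb h₀, hb h₁, hb h₂, self_mem_nhdsWithin] with q hq0 hq1 hq2 hqs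
    refine hC _ (hasTemperateGrowth_symbol (hpos q hqs))
      (h _ _ _ ?_ ?_ ?_ (hpos q hqs))
    all_goals linarith [abs_nonneg (E₀ p), abs_nonneg (E₁ p), abs_nonneg (E₂ p)]
  · rw [SchwartzMap.smulLeftCLM_apply_apply (hasTemperateGrowth_symbol (hpos p hp))]
    have h1 : Tendsto (fun q => (symbol (E₀ q) (E₁ q) (E₂ q) z : ℂ) • ψ z) (𝓝[s] p)
        (𝓝 ((symbol (E₀ p) (E₁ p) (E₂ p) z : ℂ) • ψ z)) := by
      have : ContinuousOn (fun q => symbol (E₀ q) (E₁ q) (E₂ q) z) s := by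
        unfold symbol momentForm
        fun_prop
      exact ((Complex.continuous_ofReal.tendsto _).comp (this p hp)).smul_const _
    refine h1.congr' ?_
    filter_upwards [self_mem_nhdsWithin] with q hq
    rw [SchwartzMap.smulLeftCLM_apply_apply (hasTemperateGrowth_symbol (hpos q hq))]

open scoped FourierTransform

variable {σ lam : ℝ → ℝ}

/-! ### Moments of the diffusion coefficient -/

section Moments

theorem continuous_moment (hσ : Continuous σ) (k : ℕ) :
    Continuous fun p : ℝ × ℝ => moment σ k p.1 p.2 := by
  have hc : Continuous fun s => s ^ k * σ s := by fun_prop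
  have h : ∀ p : ℝ × ℝ, moment σ k p.1 p.2 =
      (∫ s in (0 : ℝ)..p.2, s ^ k * σ s) - ∫ s in (0 : ℝ)..p.1, s ^ k * σ s := fun p =>
    (intervalIntegral.integral_interval_sub_left (hc.intervalIntegrable _ _)
      (hc.intervalIntegrable _ _)).symm
  have hp := intervalIntegral.continuous_primitive
    (fun a b => hc.intervalIntegrable (μ := volume) a b) 0
  simp only [h]
  exact (hp.comp continuous_snd).sub (hp.comp continuous_fst)

theorem hasDerivAt_moment_right (hσ : Continuous σ) (k : ℕ) (t x : ℝ) :
    HasDerivAt (fun x => moment σ k t x) (x ^ k * σ x) x :=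
  ((by fun_prop : Continuous fun s => s ^ k * σ s).integral_hasStrictDerivAt t x).hasDerivAt

theorem hasDerivAt_moment_left (hσ : Continuous σ) (k : ℕ) (t x : ℝ) :
    HasDerivAt (fun t => moment σ k t x) (-(t ^ k * σ t)) t := by
  have hc : Continuous fun s => s ^ k * σ s := by fun_prop
  exact intervalIntegral.integral_hasDerivAt_left (hc.intervalIntegrable _ _)
    (hc.stronglyMeasurableAtFilter _ _) hc.continuousAt

/-- Expanding the square under the integral produces the three moments. In this form nonnegativity
for `t ≤ x` is evident. -/
theorem momentForm_moment (hσ : Continuous σ) (t x : ℝ) (w : Phase d) :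
    momentForm (moment σ 0 t x) (moment σ 1 t x) (moment σ 2 t x) w =
      ∫ s in t..x, σ s * ‖w.snd - s • w.fst‖ ^ 2 := by
  have h : ∀ s, σ s * ‖w.snd - s • w.fst‖ ^ 2 = (s ^ 0 * σ s) * ‖w.snd‖ ^ 2 -
      (s ^ 1 * σ s) * (2 * inner ℝ w.fst w.snd) + (s ^ 2 * σ s) * ‖w.fst‖ ^ 2 := fun s => by
    rw [norm_sub_sq_real, real_inner_smul_right, norm_smul, mul_pow, Real.norm_eq_abs, sq_abs,
      real_inner_comm w.snd w.fst]
    ring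
  simp only [h]
  rw [intervalIntegral.integral_add, intervalIntegral.integral_sub,
    intervalIntegral.integral_mul_const, intervalIntegral.integral_mul_const,
    intervalIntegral.integral_mul_const, momentForm, moment, moment, moment]
  · ring
  all_goals
    apply Continuous.intervalIntegrable
    fun_prop

theorem momentForm_moment_nonneg (hσ : Continuous σ) (hpos : ∀ s, 0 < σ s) {t x : ℝ} (htx : t ≤ x)
    (w : Phase d) : 0 ≤ momentForm (moment σ 0 t x) (moment σ 1 t x) (moment σ 2 t x) w := by
  rw [momentForm_moment hσ]
  exact intervalIntegral.integral_nonneg htx fun s _ => mul_nonneg (hpos s).le (sq_nonneg _)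

theorem moment_zero_pos (hσ : Continuous σ) (hpos : ∀ s, 0 < σ s) {t x : ℝ} (htx : t < x) :
    0 < moment σ 0 t x := by
  refine intervalIntegral.intervalIntegral_pos_of_pos_on
    (Continuous.intervalIntegrable (by fun_prop) _ _) (fun s _ => ?_) htx
  simpa using hpos s

/-- The strict Cauchy-Schwarz inequality for the moments. -/
theorem moment_det_pos (hσ : Continuous σ) (hpos : ∀ s, 0 < σ s) {t x : ℝ} (htx : t < x) :
    0 < moment σ 2 t x * moment σ 0 t x - moment σ 1 t x ^ 2 := by
  have h0 := moment_zero_pos hσ hpos htx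
  -- `r` is the mean of `s` with weight `σ`; the determinant is the zeroth moment times the integral
  -- of `σ(s) (s - r)²`, which is positive because `s` is not constant on the interval.
  set r := moment σ 1 t x / moment σ 0 t x with hr
  have h : ∀ s, σ s * (s - r) ^ 2 = s ^ 2 * σ s - (s ^ 1 * σ s) * (2 * r) +
      (s ^ 0 * σ s) * r ^ 2 := fun s => by ring
  have h1 : ∫ s in t..x, σ s * (s - r) ^ 2 =
      moment σ 2 t x - moment σ 1 t x * (2 * r) + moment σ 0 t x * r ^ 2 := by
    simp only [h]
    rw [intervalIntegral.integral_add, intervalIntegral.integral_sub,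
      intervalIntegral.integral_mul_const, intervalIntegral.integral_mul_const, moment, moment,
      moment]
    all_goals
      apply Continuous.intervalIntegrable
      fun_prop
  have h2 : 0 < ∫ s in t..x, σ s * (s - r) ^ 2 := by
    obtain ⟨c, hc, hcr⟩ : ∃ c ∈ Icc t x, c ≠ r := by
      by_cases htr : t = r
      · exact ⟨x, right_mem_Icc.2 htx.le, fun h => htx.ne (htr.trans h.symm)⟩
      · exact ⟨t, left_mem_Icc.2 htx.le, htr⟩
    exact intervalIntegral.integral_pos htx (by fun_prop)
      (fun s _ => mul_nonneg (hpos s).le (sq_nonneg _))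
      ⟨c, hc, mul_pos (hpos c) (by have := sub_ne_zero.2 hcr; positivity)⟩
  rw [h1] at h2
  have h3 : moment σ 0 t x * (moment σ 2 t x - moment σ 1 t x * (2 * r) + moment σ 0 t x * r ^ 2) =
      moment σ 2 t x * moment σ 0 t x - moment σ 1 t x ^ 2 := by
    rw [hr]
    field_simp
    ring
  rw [← h3]
  exact mul_pos h0 h2

end Moments

/-! ### The propagator and its strong continuity -/

/-- The damping factor `exp (-∫_t^x lam)`. -/
def damping (lam : ℝ → ℝ) (t x : ℝ) : ℝ := Real.exp (-∫ s in t..x, lam s)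

theorem continuous_damping (hlam : Continuous lam) :
    Continuous fun p : ℝ × ℝ => damping lam p.1 p.2 := by
  have h := continuous_moment hlam 0
  simp only [moment, pow_zero, one_mul] at h
  exact Real.continuous_exp.comp h.neg

theorem hasDerivAt_damping_right (hlam : Continuous lam) (t x : ℝ) :
    HasDerivAt (fun x => damping lam t x) (-lam x * damping lam t x) x := by
  have h := (hasDerivAt_moment_right hlam 0 t x).neg.exp
  simp only [moment, pow_zero, one_mul] at h
  rw [mul_comm]
  exact h

theorem hasDerivAt_damping_left (hlam : Continuous lam) (t x : ℝ) :
    HasDerivAt (fun t => damping lam t x) (lam t * damping lam t x) t := by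
  have h := (hasDerivAt_moment_left hlam 0 t x).neg.exp
  simp only [moment, pow_zero, one_mul, neg_neg] at h
  rw [mul_comm]
  exact h

/-- The Fourier transform of the propagator of the equation without damping. -/
def fourierPropagator (d : ℕ) (σ : ℝ → ℝ) (t x : ℝ) : 𝓢(Phase d, ℂ) →L[ℂ] 𝓢(Phase d, ℂ) :=
  SchwartzMap.compCLMOfContinuousLinearEquiv ℂ (coshear (-t)) ∘L
    SchwartzMap.smulLeftCLM ℂ (fun w : Phase d =>
      (symbol (moment σ 0 t x) (moment σ 1 t x) (moment σ 2 t x) w : ℂ)) ∘L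
    SchwartzMap.compCLMOfContinuousLinearEquiv ℂ (coshear x)

/-- The propagator of the adjoint of the pencil-beam equation. -/
def propagator (d : ℕ) (σ lam : ℝ → ℝ) (t x : ℝ) : 𝓢(Phase d, ℂ) →L[ℂ] 𝓢(Phase d, ℂ) :=
  (damping lam t x : ℂ) • (FourierTransform.fourierInvCLM ℂ 𝓢(Phase d, ℂ) ∘L
    fourierPropagator d σ t x ∘L FourierTransform.fourierCLM ℂ 𝓢(Phase d, ℂ))

/-- The condition `t ≤ x` makes the form nonnegative and hence the symbol of temperate growth, as
`smulLeftCLM` requires in order to be multiplication. -/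
theorem fourierPropagator_apply (hσ : Continuous σ) (hpos : ∀ s, 0 < σ s) {t x : ℝ} (htx : t ≤ x)
    (ψ : 𝓢(Phase d, ℂ)) (w : Phase d) :
    fourierPropagator d σ t x ψ w =
      (symbol (moment σ 0 t x) (moment σ 1 t x) (moment σ 2 t x) (coshear (-t) w) : ℂ) *
        ψ (coshear x (coshear (-t) w)) :=
  SchwartzMap.smulLeftCLM_apply_apply
    (hasTemperateGrowth_symbol (momentForm_moment_nonneg hσ hpos htx)) _ _

theorem fourier_propagator (t x : ℝ) (φ : 𝓢(Phase d, ℂ)) :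
    𝓕 (propagator d σ lam t x φ) =
      (damping lam t x : ℂ) • fourierPropagator d σ t x (𝓕 φ) := by
  rw [propagator, smul_apply, FourierTransform.fourier_smul]
  congr 1
  exact FourierTransform.fourier_fourierInv_eq _

/-- Each of the three factors is strongly continuous; Banach-Steinhaus allows them to be composed.
-/
theorem continuousOn_fourierPropagator (hσ : Continuous σ) (hpos : ∀ s, 0 < σ s)
    (ψ : 𝓢(Phase d, ℂ)) :
    ContinuousOn (fun p : ℝ × ℝ => fourierPropagator d σ p.1 p.2 ψ)
      {p | 0 ≤ p.1 ∧ p.1 ≤ p.2} := by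
  intro p hp
  have h1 : Tendsto (fun p : ℝ × ℝ =>
      SchwartzMap.compCLMOfContinuousLinearEquiv ℂ (coshear p.2) ψ)
      (𝓝[{p | 0 ≤ p.1 ∧ p.1 ≤ p.2}] p)
      (𝓝 (SchwartzMap.compCLMOfContinuousLinearEquiv ℂ (coshear p.2) ψ)) :=
    ((continuous_compCLM_coshear ψ).comp continuous_snd).continuousWithinAt
  have h2 := ContinuousLinearMap.tendsto_apply_of_barrelled (𝕜 := ℂ)
    (T := fun p : ℝ × ℝ => SchwartzMap.smulLeftCLM ℂ (fun w : Phase d =>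
      (symbol (moment σ 0 p.1 p.2) (moment σ 1 p.1 p.2) (moment σ 2 p.1 p.2) w : ℂ)))
    (T₀ := SchwartzMap.smulLeftCLM ℂ (fun w : Phase d =>
      (symbol (moment σ 0 p.1 p.2) (moment σ 1 p.1 p.2) (moment σ 2 p.1 p.2) w : ℂ)))
    (fun ψ => continuousOn_smulLeftCLM_symbol (continuous_moment hσ 0).continuousOn
      (continuous_moment hσ 1).continuousOn (continuous_moment hσ 2).continuousOn
      (fun q hq => momentForm_moment_nonneg hσ hpos hq.2) ψ p hp) h1
  exact ContinuousLinearMap.tendsto_apply_of_barrelled (𝕜 := ℂ)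
    (T := fun p : ℝ × ℝ => SchwartzMap.compCLMOfContinuousLinearEquiv ℂ (coshear (-p.1)))
    (T₀ := SchwartzMap.compCLMOfContinuousLinearEquiv ℂ (coshear (-p.1)))
    (fun ψ => ((continuous_compCLM_coshear ψ).comp continuous_fst.neg).continuousWithinAt) h2

theorem continuousOn_propagator (hσ : Continuous σ) (hpos : ∀ s, 0 < σ s) (hlam : Continuous lam)
    (φ : 𝓢(Phase d, ℂ)) :
    ContinuousOn (fun p : ℝ × ℝ => propagator d σ lam p.1 p.2 φ) {p | 0 ≤ p.1 ∧ p.1 ≤ p.2} :=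
  (Complex.continuous_ofReal.comp (continuous_damping hlam)).continuousOn.smul
    ((FourierTransform.fourierInvCLM ℂ 𝓢(Phase d, ℂ)).continuous.comp_continuousOn
      (continuousOn_fourierPropagator hσ hpos (𝓕 φ)))

theorem propagator_self (x : ℝ) (φ : 𝓢(Phase d, ℂ)) : propagator d σ lam x x φ = φ := by
  have h1 : fourierPropagator d σ x x (𝓕 φ) = 𝓕 φ := by
    ext w
    have h2 : (fun w : Phase d =>
        (symbol (moment σ 0 x x) (moment σ 1 x x) (moment σ 2 x x) w : ℂ)) = fun _ => 1 := by
      ext w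
      simp [symbol, momentForm, moment]
    rw [fourierPropagator, h2]
    simp only [ContinuousLinearMap.comp_apply, SchwartzMap.smulLeftCLM_const, one_smul]
    change 𝓕 φ (coshear x (coshear (-x) w)) = _
    congr 1
    simpa using coshear_neg_coshear (-x) w
  have h3 : 𝓕⁻ (fourierPropagator d σ x x (𝓕 φ)) = φ := by
    rw [h1]
    exact FourierTransform.fourierInv_fourier_eq φ
  rw [propagator, damping, intervalIntegral.integral_same, neg_zero, Real.exp_zero,
    Complex.ofReal_one, one_smul]
  exact h3

/-! ### The generator and its Fourier transform -/

section Generator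

/-- The adjoint of `laplacianV`. -/
def laplacianVCLM (d : ℕ) : 𝓢(Phase d, ℂ) →L[ℂ] 𝓢(Phase d, ℂ) :=
  ∑ i : Fin d, LineDeriv.lineDerivOpCLM ℂ 𝓢(Phase d, ℂ) (eV i : Phase d) ∘L
    LineDeriv.lineDerivOpCLM ℂ 𝓢(Phase d, ℂ) (eV i : Phase d)

/-- The adjoint of `-transport`. -/
def transportCLM (d : ℕ) : 𝓢(Phase d, ℂ) →L[ℂ] 𝓢(Phase d, ℂ) :=
  ∑ i : Fin d, LineDeriv.lineDerivOpCLM ℂ 𝓢(Phase d, ℂ) (eX i : Phase d) ∘L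
    SchwartzMap.smulLeftCLM ℂ (fun z : Phase d => ((z.snd i : ℝ) : ℂ))

/-- The generator of the adjoint of the pencil-beam equation. -/
def generator (d : ℕ) (σ lam : ℝ → ℝ) (x : ℝ) : 𝓢(Phase d, ℂ) →L[ℂ] 𝓢(Phase d, ℂ) :=
  (σ x : ℂ) • laplacianVCLM d + transportCLM d - (lam x : ℂ) • ContinuousLinearMap.id ℂ _

theorem continuous_generator (hσ : Continuous σ) (hlam : Continuous lam) (φ : 𝓢(Phase d, ℂ)) :
    Continuous fun x => generator d σ lam x φ := by
  simp only [generator, sub_apply, add_apply, smul_apply]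
  exact (((Complex.continuous_ofReal.comp hσ).smul continuous_const).add continuous_const).sub
    ((Complex.continuous_ofReal.comp hlam).smul continuous_const)

theorem laplacianV_apply (U : 𝓢'(Phase d, ℂ)) (φ : 𝓢(Phase d, ℂ)) :
    laplacianV U φ = U (laplacianVCLM d φ) := by
  simp only [laplacianV, laplacianVCLM, FunLike.coe_sum, Finset.sum_apply, map_sum,
    TemperedDistribution.lineDerivOp_apply_apply, ContinuousLinearMap.comp_apply,
    LineDeriv.lineDerivOpCLM_apply, LineDeriv.lineDerivOp_neg, neg_neg]

theorem transport_apply (U : 𝓢'(Phase d, ℂ)) (φ : 𝓢(Phase d, ℂ)) :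
    transport U φ = -U (transportCLM d φ) := by
  simp only [transport, transportCLM, FunLike.coe_sum, Finset.sum_apply, map_sum,
    TemperedDistribution.lineDerivOp_apply_apply, ContinuousLinearMap.comp_apply,
    TemperedDistribution.smulLeftCLM_apply_apply,
    LineDeriv.lineDerivOpCLM_apply, map_neg, Finset.sum_neg_distrib]

theorem inner_eV (w : Phase d) (i : Fin d) : inner ℝ w (eV i) = w.snd i := by
  rw [WithLp.prod_inner_apply]
  change inner ℝ w.fst (0 : EuclideanSpace ℝ (Fin d)) +
    inner ℝ w.snd (EuclideanSpace.single i 1) = _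
  rw [inner_zero_right, zero_add, EuclideanSpace.inner_single_right]
  simp

theorem inner_eX (w : Phase d) (i : Fin d) : inner ℝ w (eX i) = w.fst i := by
  rw [WithLp.prod_inner_apply]
  change inner ℝ w.fst (EuclideanSpace.single i 1) +
    inner ℝ w.snd (0 : EuclideanSpace ℝ (Fin d)) = _
  rw [inner_zero_right, add_zero, EuclideanSpace.inner_single_right]
  simp

theorem fourier_lineDeriv_apply (φ : 𝓢(Phase d, ℂ)) (m w : Phase d) :
    𝓕 (∂_{m} φ) w = 2 * Real.pi * Complex.I * (inner ℝ w m : ℝ) * 𝓕 φ w := by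
  have : (fun w : Phase d => inner ℝ w m).HasTemperateGrowth := by fun_prop
  rw [SchwartzMap.fourier_lineDerivOp_eq, smul_apply,
    SchwartzMap.smulLeftCLM_apply_apply this, Complex.real_smul, smul_eq_mul]
  ring

theorem fourier_laplacianVCLM (φ : 𝓢(Phase d, ℂ)) (w : Phase d) :
    𝓕 (laplacianVCLM d φ) w = -(4 * Real.pi ^ 2 * ‖w.snd‖ ^ 2 : ℝ) * 𝓕 φ w := by
  have h1 : 𝓕 (laplacianVCLM d φ) =
      ∑ i : Fin d, 𝓕 (∂_{(eV i : Phase d)} (∂_{(eV i : Phase d)} φ)) := by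
    simp [laplacianVCLM]
  rw [h1, FunLike.coe_sum, Finset.sum_apply]
  simp only [fourier_lineDeriv_apply, inner_eV]
  rw [EuclideanSpace.real_norm_sq_eq, Finset.mul_sum, Complex.ofReal_sum, ← Finset.sum_neg_distrib,
    Finset.sum_mul]
  refine Finset.sum_congr rfl fun i _ => ?_
  push_cast
  linear_combination (4 * Real.pi ^ 2 * (w.snd i : ℂ) ^ 2 * 𝓕 φ w) * Complex.I_sq

theorem sum_smul_eV (v : EuclideanSpace ℝ (Fin d)) :
    ∑ i : Fin d, v i • (eV i : Phase d) = WithLp.toLp 2 (0, v) := by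
  have h := (EuclideanSpace.basisFun (Fin d) ℝ).sum_repr v
  simp only [EuclideanSpace.basisFun_repr, EuclideanSpace.basisFun_apply] at h
  refine ext_inner_left ℝ fun w => ?_
  rw [inner_sum]
  simp only [real_inner_smul_right, inner_eV]
  rw [WithLp.prod_inner_apply]
  change _ = inner ℝ w.fst (0 : EuclideanSpace ℝ (Fin d)) + inner ℝ w.snd v
  rw [inner_zero_right, zero_add, PiLp.inner_apply]
  rfl

/-- Multiplication by `V_i` becomes `-(2πi)⁻¹ ∂_{η_i}` and `∂_{X'_i}` becomes `2πi ξ_i`. The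
constants cancel to the real vector field `-ξ · ∇_η`, whose flow is `coshear`. -/
theorem fourier_transportCLM (φ : 𝓢(Phase d, ℂ)) (w : Phase d) :
    𝓕 (transportCLM d φ) w = -fderiv ℝ (𝓕 φ : 𝓢(Phase d, ℂ)) w (WithLp.toLp 2 (0, w.fst)) := by
  have h1 : 𝓕 (transportCLM d φ) = ∑ i : Fin d, 𝓕 (∂_{(eX i : Phase d)}
      (SchwartzMap.smulLeftCLM ℂ (fun z : Phase d => ((z.snd i : ℝ) : ℂ)) φ)) := by
    simp [transportCLM]
  have h2 : ∀ i : Fin d, fderiv ℝ (𝓕 φ : 𝓢(Phase d, ℂ)) w (eV i) = -(2 * Real.pi * Complex.I) *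
      𝓕 (SchwartzMap.smulLeftCLM ℂ (fun z : Phase d => ((z.snd i : ℝ) : ℂ)) φ) w := by
    intro i
    have hg : (fun z : Phase d => z.snd i).HasTemperateGrowth := by
      have : (fun z : Phase d => inner ℝ z (eV i)).HasTemperateGrowth := by fun_prop
      simpa only [inner_eV] using this
    have h := congrArg (fun f => f w) (SchwartzMap.lineDerivOp_fourier_eq φ (eV i : Phase d))
    simp only [inner_eV] at h
    rw [← SchwartzMap.smulLeftCLM_ofReal ℂ hg, FourierTransform.fourier_smul] at h
    exact h
  rw [h1, FunLike.coe_sum, Finset.sum_apply, ← sum_smul_eV, map_sum, ← Finset.sum_neg_distrib]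
  refine Finset.sum_congr rfl fun i _ => ?_
  rw [fourier_lineDeriv_apply, inner_eX, map_smul, h2, Complex.real_smul]
  ring

theorem fourier_generator (x : ℝ) (φ : 𝓢(Phase d, ℂ)) (w : Phase d) :
    𝓕 (generator d σ lam x φ) w = -(4 * Real.pi ^ 2 * (σ x * ‖w.snd‖ ^ 2) : ℝ) * 𝓕 φ w -
      fderiv ℝ (𝓕 φ : 𝓢(Phase d, ℂ)) w (WithLp.toLp 2 (0, w.fst)) - lam x * 𝓕 φ w := by
  have h1 : 𝓕 (generator d σ lam x φ) = (σ x : ℂ) • 𝓕 (laplacianVCLM d φ) +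
      𝓕 (transportCLM d φ) - (lam x : ℂ) • 𝓕 φ := by
    have h := FourierTransform.fourierCLM_apply (R := ℂ) (generator d σ lam x φ)
    rw [← h]
    simp only [generator, sub_apply, add_apply, smul_apply, map_sub, map_add, map_smul]
    rfl
  rw [h1, sub_apply, add_apply, smul_apply, smul_apply, fourier_laplacianVCLM,
    fourier_transportCLM, smul_eq_mul, smul_eq_mul]
  push_cast
  ring

end Generator

/-! ### Differentiation of the propagator along characteristics -/

theorem coshear_eq_sub (c : ℝ) (z : Phase d) :
    coshear c z = z - c • (WithLp.toLp 2 (0, z.fst) : Phase d) :=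
  WithLp.ofLp_injective 2 (Prod.ext (by
    change z.fst = z.fst - c • (0 : EuclideanSpace ℝ (Fin d))
    simp) rfl)

theorem coshear_coshear (a b : ℝ) (z : Phase d) : coshear a (coshear b z) = coshear (a + b) z :=
  WithLp.ofLp_injective 2 (Prod.ext rfl (by
    change z.snd - b • z.fst - a • z.fst = z.snd - (a + b) • z.fst
    module))

theorem hasDerivAt_comp_coshear (ψ : 𝓢(Phase d, ℂ)) (c : ℝ) (z : Phase d) :
    HasDerivAt (fun c => ψ (coshear c z))
      (-fderiv ℝ ψ (coshear c z) (WithLp.toLp 2 (0, z.fst))) c := by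
  have h1 : HasDerivAt (fun s : ℝ => ψ (coshear c z + s • (-(WithLp.toLp 2 (0, z.fst) : Phase d))))
      (fderiv ℝ ψ (coshear c z) (-(WithLp.toLp 2 (0, z.fst) : Phase d))) (c - c) := by
    rw [sub_self]
    exact (ψ.hasFDerivAt (x := coshear c z)).hasLineDerivAt _
  rw [map_neg] at h1
  refine (h1.comp_sub_const c c).congr_of_eventuallyEq (Eventually.of_forall fun b => ?_)
  change ψ (coshear b z) = ψ _
  congr 1
  rw [coshear_eq_sub, coshear_eq_sub]
  module

/-- Applied to the derivatives `s ^ k σ(s)` of the moments, this identifies the derivative of the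
exponent with the multiplier of `σ Δ_V` at the sheared point. -/
theorem momentForm_pow_mul (a s : ℝ) (u : Phase d) :
    momentForm (s ^ 0 * a) (s ^ 1 * a) (s ^ 2 * a) u = a * ‖(coshear s u).snd‖ ^ 2 := by
  rw [momentForm, coshear_snd, norm_sub_sq_real, real_inner_smul_right, norm_smul, mul_pow,
    Real.norm_eq_abs, sq_abs, real_inner_comm u.snd u.fst]
  ring

theorem hasDerivAt_symbol_moments {E₀ E₁ E₂ : ℝ → ℝ} {E₀' E₁' E₂' x : ℝ}
    (h₀ : HasDerivAt E₀ E₀' x) (h₁ : HasDerivAt E₁ E₁' x) (h₂ : HasDerivAt E₂ E₂' x) (w : Phase d) :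
    HasDerivAt (fun x => symbol (E₀ x) (E₁ x) (E₂ x) w)
      (symbol (E₀ x) (E₁ x) (E₂ x) w * -(4 * Real.pi ^ 2 * momentForm E₀' E₁' E₂' w)) x := by
  refine HasDerivAt.exp (((?_ : HasDerivAt (fun x => momentForm (E₀ x) (E₁ x) (E₂ x) w)
    (momentForm E₀' E₁' E₂' w) x).const_mul _).neg)
  exact ((h₀.mul_const _).sub ((h₁.const_mul 2).mul_const _)).add (h₂.mul_const _)

theorem hasDerivAt_momentForm_coshear {E₀ E₁ E₂ : ℝ → ℝ} {E₀' E₁' E₂' x : ℝ}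
    (h₀ : HasDerivAt E₀ E₀' x) (h₁ : HasDerivAt E₁ E₁' x) (h₂ : HasDerivAt E₂ E₂' x) (w : Phase d) :
    HasDerivAt (fun x => momentForm (E₀ x) (E₁ x) (E₂ x) (coshear (-x) w))
      (momentForm E₀' E₁' E₂' (coshear (-x) w) +
        2 * (E₀ x * inner ℝ w.fst (coshear (-x) w).snd - E₁ x * ‖w.fst‖ ^ 2)) x := by
  have h : HasDerivAt (fun x : ℝ => w.snd - (-x) • w.fst) w.fst x := by
    simpa using ((hasDerivAt_neg x).smul_const w.fst).const_sub w.snd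
  have := ((h₀.mul h.norm_sq).sub
    ((h₁.const_mul 2).mul ((hasDerivAt_const x w.fst).inner ℝ h))).add (h₂.mul_const (‖w.fst‖ ^ 2))
  refine this.congr_deriv ?_
  rw [inner_zero_left, real_inner_self_eq_norm_sq, momentForm, coshear_snd, coshear_fst,
    real_inner_comm w.fst]
  ring

theorem fourier_propagator_apply (hσ : Continuous σ) (hpos : ∀ s, 0 < σ s) {t x : ℝ} (htx : t ≤ x)
    (φ : 𝓢(Phase d, ℂ)) (w : Phase d) :
    𝓕 (propagator d σ lam t x φ) w = (damping lam t x : ℂ) *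
      ((symbol (moment σ 0 t x) (moment σ 1 t x) (moment σ 2 t x) (coshear (-t) w) : ℂ) *
        𝓕 φ (coshear x (coshear (-t) w))) := by
  rw [fourier_propagator, smul_apply, fourierPropagator_apply hσ hpos htx, smul_eq_mul]

/-- The product rule over damping, symbol and shear reproduces the three terms of the generator.
Strictness of `t < x` keeps the explicit formula valid near `x`. -/
theorem hasDerivAt_fourier_propagator_right (hσ : Continuous σ) (hpos : ∀ s, 0 < σ s)
    (hlam : Continuous lam) {t x : ℝ} (htx : t < x) (φ : 𝓢(Phase d, ℂ)) (w : Phase d) :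
    HasDerivAt (fun x => 𝓕 (propagator d σ lam t x φ) w)
      (𝓕 (propagator d σ lam t x (generator d σ lam x φ)) w) x := by
  have h := (hasDerivAt_damping_right hlam t x).ofReal_comp.mul
    ((hasDerivAt_symbol_moments (hasDerivAt_moment_right hσ 0 t x)
      (hasDerivAt_moment_right hσ 1 t x) (hasDerivAt_moment_right hσ 2 t x)
        (coshear (-t) w)).ofReal_comp.mul
      (hasDerivAt_comp_coshear (𝓕 φ : 𝓢(Phase d, ℂ)) x (coshear (-t) w)))
  refine (h.congr_of_eventuallyEq ?_).congr_deriv ?_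
  · filter_upwards [Ioi_mem_nhds htx] with y hy
    exact fourier_propagator_apply hσ hpos (le_of_lt hy) φ w
  · rw [fourier_propagator_apply hσ hpos htx.le, fourier_generator, momentForm_pow_mul]
    simp only [coshear_fst, Pi.mul_apply]
    push_cast
    ring

theorem hasDerivAt_fourier_propagator_left (hσ : Continuous σ) (hpos : ∀ s, 0 < σ s)
    (hlam : Continuous lam) {t x : ℝ} (htx : t < x) (φ : 𝓢(Phase d, ℂ)) (w : Phase d) :
    HasDerivAt (fun t => 𝓕 (propagator d σ lam t x φ) w)
      (-𝓕 (generator d σ lam t (propagator d σ lam t x φ)) w) t := by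
  -- The value of `κ` is irrelevant: the same term appears in the `t`-derivative and in the
  -- directional derivative `hdir`, and the two cancel.
  obtain ⟨κ, hκ⟩ : ∃ κ, HasDerivAt (fun r => 𝓕 φ (coshear x (coshear (-r) w))) κ t := by
    have h := hasDerivAt_comp_coshear (𝓕 φ : 𝓢(Phase d, ℂ)) (x - t) w
    have := h.scomp t ((hasDerivAt_id t).const_sub x)
    simp only [Function.comp_def, sub_eq_add_neg, ← coshear_coshear] at this
    exact ⟨_, this⟩
  -- Used twice: with the actual moments for the `t`-derivative, and with frozen moments for the
  -- directional derivative.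
  have key : ∀ {e E₀ E₁ E₂ : ℝ → ℝ} {e' E₀' E₁' E₂' : ℝ}, HasDerivAt e e' t →
      HasDerivAt E₀ E₀' t → HasDerivAt E₁ E₁' t → HasDerivAt E₂ E₂' t →
      HasDerivAt (fun r => (e r : ℂ) * ((symbol (E₀ r) (E₁ r) (E₂ r) (coshear (-r) w) : ℂ) *
        𝓕 φ (coshear x (coshear (-r) w))))
        ((e' : ℂ) * ((symbol (E₀ t) (E₁ t) (E₂ t) (coshear (-t) w) : ℂ) *
            𝓕 φ (coshear x (coshear (-t) w))) +
          (e t : ℂ) * ((symbol (E₀ t) (E₁ t) (E₂ t) (coshear (-t) w) *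
            -(4 * Real.pi ^ 2 * (momentForm E₀' E₁' E₂' (coshear (-t) w) + 2 * (E₀ t *
              inner ℝ w.fst (coshear (-t) w).snd - E₁ t * ‖w.fst‖ ^ 2))) : ℝ) *
                𝓕 φ (coshear x (coshear (-t) w)) +
            (symbol (E₀ t) (E₁ t) (E₂ t) (coshear (-t) w) : ℂ) * κ)) t := fun he h₀ h₁ h₂ =>
    he.ofReal_comp.mul ((((hasDerivAt_momentForm_coshear h₀ h₁ h₂ w).const_mul
      (4 * Real.pi ^ 2)).neg.exp).ofReal_comp.mul hκ)
  -- The curve `r ↦ coshear (t - r) w` passes through `w` at `r = t` with velocity `(0, ξ)`, and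
  -- `coshear (-t)` maps it to `coshear (-r) w`. The derivative along it is thus `key` with damping
  -- and moments held constant.
  have hdir : fderiv ℝ (𝓕 (propagator d σ lam t x φ) : 𝓢(Phase d, ℂ)) w
      (WithLp.toLp 2 (0, w.fst)) =
        (damping lam t x : ℂ) * ((symbol (moment σ 0 t x) (moment σ 1 t x) (moment σ 2 t x)
          (coshear (-t) w) * -(4 * Real.pi ^ 2 * (2 * (moment σ 0 t x *
              inner ℝ w.fst (coshear (-t) w).snd - moment σ 1 t x * ‖w.fst‖ ^ 2))) : ℝ) *
                𝓕 φ (coshear x (coshear (-t) w)) +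
            (symbol (moment σ 0 t x) (moment σ 1 t x) (moment σ 2 t x) (coshear (-t) w) : ℂ) * κ) := by
    have h1 := hasDerivAt_comp_coshear (𝓕 (propagator d σ lam t x φ) : 𝓢(Phase d, ℂ)) (t - t) w
    have h2 := h1.scomp t ((hasDerivAt_id t).const_sub t)
    have h3 := key (hasDerivAt_const t (damping lam t x)) (hasDerivAt_const t (moment σ 0 t x))
      (hasDerivAt_const t (moment σ 1 t x)) (hasDerivAt_const t (moment σ 2 t x))
    have h4 : ∀ r, 𝓕 (propagator d σ lam t x φ) (coshear (t - r) w) = (damping lam t x : ℂ) *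
        ((symbol (moment σ 0 t x) (moment σ 1 t x) (moment σ 2 t x) (coshear (-r) w) : ℂ) *
          𝓕 φ (coshear x (coshear (-r) w))) := by
      intro r
      rw [fourier_propagator_apply hσ hpos htx.le, coshear_coshear (-t),
        show -t + (t - r) = -r by ring]
    simp only [Function.comp_def, h4] at h2
    have h5 := h2.unique h3
    have h6 : coshear 0 w = w := by simp [coshear_eq_sub]
    rw [sub_self, h6] at h5
    simpa [momentForm] using h5
  refine ((key (hasDerivAt_damping_left hlam t x) (hasDerivAt_moment_left hσ 0 t x)
    (hasDerivAt_moment_left hσ 1 t x) (hasDerivAt_moment_left hσ 2 t x)).congr_of_eventuallyEq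
      ?_).congr_deriv ?_
  · filter_upwards [Iio_mem_nhds htx] with y hy
    exact fourier_propagator_apply hσ hpos (le_of_lt hy) φ w
  · rw [fourier_generator, hdir, fourier_propagator_apply hσ hpos htx.le]
    have h7 : ∀ u : Phase d, momentForm (-(t ^ 0 * σ t)) (-(t ^ 1 * σ t)) (-(t ^ 2 * σ t)) u =
        -(σ t * ‖(coshear t u).snd‖ ^ 2) := fun u => by
      rw [← momentForm_pow_mul, momentForm, momentForm]
      ring
    have h8 : coshear t (coshear (-t) w) = w := by
      simpa using coshear_neg_coshear (-t) w
    rw [h7, h8]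
    push_cast
    ring

theorem tendsto_slope_of_fourier {f : ℝ → 𝓢(Phase d, ℂ)} {g : 𝓢(Phase d, ℂ)} {x : ℝ}
    {l : Filter ℝ} (h : Tendsto (slope (fun s => 𝓕 (f s)) x) l (𝓝 (𝓕 g))) :
    Tendsto (slope f x) l (𝓝 g) := by
  have h1 := ((FourierTransform.fourierInvCLM ℝ 𝓢(Phase d, ℂ)).continuous.tendsto _).comp h
  rw [FourierTransform.fourierInvCLM_apply, FourierTransform.fourierInv_fourier_eq] at h1
  refine h1.congr fun y => ?_
  rw [Function.comp_apply, slope_def_module, map_smul, map_sub,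
    FourierTransform.fourierInvCLM_apply, FourierTransform.fourierInvCLM_apply,
    FourierTransform.fourierInv_fourier_eq, FourierTransform.fourierInv_fourier_eq,
    slope_def_module]

theorem isEvolution_propagator (hσ : Continuous σ) (hpos : ∀ s, 0 < σ s) (hlam : Continuous lam) :
    SchwartzMap.IsEvolution (propagator d σ lam) (generator d σ lam) where
  apply_self x _ φ := propagator_self x φ
  continuousOn := continuousOn_propagator hσ hpos hlam
  continuousOn_generator φ := (continuous_generator hσ hlam φ).continuousOn
  tendsto_slope_right φ t b ht x hx := by
    have hF := (FourierTransform.fourierCLM ℂ 𝓢(Phase d, ℂ)).continuous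
    have hQ : ∀ φ, ContinuousOn (fun x => propagator d σ lam t x φ) (Icc t b) := fun φ =>
      (continuousOn_propagator hσ hpos hlam φ).comp (f := fun x => (t, x)) (by fun_prop)
        fun x hx => ⟨ht, hx.1⟩
    -- Pointwise derivatives are needed only in the open interval; the endpoint `x = t`, where the
    -- form degenerates, is reached by continuity of `Q` and of the proposed derivative.
    refine tendsto_slope_of_fourier (SchwartzMap.tendsto_slope_of_hasDerivAt_apply
      (f := fun x => 𝓕 (propagator d σ lam t x φ))
      (g := fun x => 𝓕 (propagator d σ lam t x (generator d σ lam x φ)))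
      (hF.comp_continuousOn (hQ φ)) (hF.comp_continuousOn fun x hx => ?_)
      (fun w s hs => hasDerivAt_fourier_propagator_right hσ hpos hlam hs.1 φ w) hx)
    exact ContinuousLinearMap.tendsto_apply_of_barrelled (𝕜 := ℂ)
      (T := fun x => propagator d σ lam t x) (T₀ := propagator d σ lam t x)
      (fun ψ => hQ ψ x hx) (continuous_generator hσ hlam φ).continuousWithinAt
  tendsto_slope_left φ x t ht := by
    have hF := (FourierTransform.fourierCLM ℂ 𝓢(Phase d, ℂ)).continuous
    have hQ : ContinuousOn (fun t => propagator d σ lam t x φ) (Icc 0 x) :=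
      (continuousOn_propagator hσ hpos hlam φ).comp (f := fun t => (t, x)) (by fun_prop)
        fun t ht => ht
    have hneg : ∀ φ : 𝓢(Phase d, ℂ), 𝓕 (-φ) = -𝓕 φ := fun φ =>
      map_neg (FourierTransform.fourierCLM ℂ 𝓢(Phase d, ℂ)) φ
    refine tendsto_slope_of_fourier (SchwartzMap.tendsto_slope_of_hasDerivAt_apply
      (f := fun t => 𝓕 (propagator d σ lam t x φ))
      (g := fun t => 𝓕 (-generator d σ lam t (propagator d σ lam t x φ)))
      (hF.comp_continuousOn hQ) (hF.comp_continuousOn (ContinuousOn.neg fun t ht => ?_))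
      (fun w s hs => ?_) ht)
    · exact ContinuousLinearMap.tendsto_apply_of_barrelled (𝕜 := ℂ)
        (T := fun t => generator d σ lam t) (T₀ := generator d σ lam t)
        (fun ψ => (continuous_generator hσ hlam ψ).continuousWithinAt) (hQ t ht)
    · rw [hneg]
      exact hasDerivAt_fourier_propagator_left hσ hpos hlam hs.2 φ w

/-! ### Identification with the Gaussian kernels -/

/-- The propagator is the adjoint of the convolution operator in the explicit formula. -/
theorem propagator_eq_convolution (hσ : Continuous σ) (hpos : ∀ s, 0 < σ s) {t x : ℝ}
    (htx : t < x) (φ : 𝓢(Phase d, ℂ)) :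
    propagator d σ lam t x φ = (damping lam t x : ℂ) •
      SchwartzMap.compCLMOfContinuousLinearEquiv ℂ (shear (-t))
        (SchwartzMap.convolution (ContinuousLinearMap.mul ℂ ℂ)
          (SchwartzMap.compCLMOfContinuousLinearEquiv ℂ (ContinuousLinearEquiv.neg ℝ) (H₂ d σ x t))
          (SchwartzMap.compCLMOfContinuousLinearEquiv ℂ (shear x) φ)) := by
  have h₀ := moment_zero_pos hσ hpos htx
  have hΔ := moment_det_pos hσ hpos htx
  -- On the Fourier side the shears become coshears and the convolution becomes multiplication by
  -- the symbol, which is the definition of `fourierPropagator`.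
  apply (FourierTransform.fourierEquiv ℂ 𝓢(Phase d, ℂ)).injective
  change 𝓕 (propagator d σ lam t x φ) = 𝓕 (_ : 𝓢(Phase d, ℂ))
  ext w
  rw [fourier_propagator_apply hσ hpos htx.le, FourierTransform.fourier_smul, smul_apply,
    smul_eq_mul, fourier_compCLM_shear, H₂, gaussianKernel_comp_neg h₀ hΔ]
  rw [SchwartzMap.fourier_convolution, SchwartzMap.compCLMOfContinuousLinearEquiv_apply,
    Function.comp_apply, SchwartzMap.pairing_apply_apply, fourier_gaussianKernel h₀ hΔ,
    fourier_compCLM_shear]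
  rfl

/-- Each operation on `T` is precomposition with its adjoint, so the pairing unfolds to `T`
evaluated at these adjoints applied in reverse order. -/
theorem damping_smul_translate_conv_translate (hσ : Continuous σ) (hpos : ∀ s, 0 < σ s) {t x : ℝ}
    (htx : t < x) (T : 𝓢'(Phase d, ℂ)) (φ : 𝓢(Phase d, ℂ)) :
    damping lam t x • translate x (conv (H₂ d σ x t) (translate (-t) T)) φ =
      T (propagator d σ lam t x φ) := by
  rw [propagator_eq_convolution hσ hpos htx, map_smul, ← Complex.coe_smul]
  rfl

theorem damping_smul_translate_conv (hσ : Continuous σ) (hpos : ∀ s, 0 < σ s) {x : ℝ}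
    (hx : 0 < x) (T : 𝓢'(Phase d, ℂ)) (φ : 𝓢(Phase d, ℂ)) :
    damping lam 0 x • translate x (conv (H₁ d σ x) T) φ = T (propagator d σ lam 0 x φ) := by
  rw [← damping_smul_translate_conv_translate hσ hpos hx]
  have h : translate (-0) T = T := by
    ext φ
    change T (SchwartzMap.compCLMOfContinuousLinearEquiv ℂ (shear (-0)) φ) = T φ
    congr 1
    ext z
    change φ (shear (-0) z) = φ z
    congr 1
    exact WithLp.ofLp_injective 2 (Prod.ext (by
      change z.fst + (-0 : ℝ) • z.snd = z.fst
      simp) rfl)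
  rw [h]
  rfl

/-! ### The Cauchy problem for tempered distributions -/

theorem hasDeriv_iff {U : ℝ → 𝓢'(Phase d, ℂ)} {U' : 𝓢'(Phase d, ℂ)} {x : ℝ} :
    HasDeriv U U' x ↔ ∀ φ, HasDerivWithinAt (fun y => U y φ) (U' φ) (Ici 0) x := by
  rw [HasDeriv, PointwiseConvergenceCLM.tendsto_iff_forall_tendsto]
  refine forall_congr' fun φ => ?_
  rw [hasDerivWithinAt_iff_tendsto_slope]
  rfl

theorem HasDeriv.unique {U : ℝ → 𝓢'(Phase d, ℂ)} {U' V' : 𝓢'(Phase d, ℂ)} {x : ℝ} (hx : 0 ≤ x)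
    (hU : HasDeriv U U' x) (hV : HasDeriv U V' x) : U' = V' := by
  ext φ
  exact (uniqueDiffOn_Ici (0 : ℝ) x hx).eq_deriv _ (hasDeriv_iff.1 hU φ) (hasDeriv_iff.1 hV φ)

/-- The equation, tested with a Schwartz function. -/
theorem equation_iff {s l x : ℝ} (hs : s = σ x) (hl : l = lam x) {u u' f : 𝓢'(Phase d, ℂ)} :
    -(s • laplacianV u) + transport u + u' + l • u = f ↔
      ∀ φ, u' φ = u (generator d σ lam x φ) + f φ := by
  have h : ∀ φ, (-(s • laplacianV u) + transport u + u' + l • u) φ =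
      u' φ - u (generator d σ lam x φ) := fun φ => by
    change -(s • laplacianV u φ) + transport u φ + u' φ + l • u φ = _
    rw [laplacianV_apply, transport_apply, generator]
    simp only [sub_apply, add_apply, smul_apply, map_sub, map_add, map_smul,
      ContinuousLinearMap.id_apply, hs, hl]
    rw [Complex.coe_smul, Complex.coe_smul]
    abel
  constructor
  · rintro rfl φ
    rw [h]
    ring
  · intro h'
    ext φ
    rw [h, h']
    ring

/-- The propagator is built from `σ` and `lam`, continuous on the whole line; the equation involves
`σ₀` and `lam₀`, which only need to agree with them on the half-line. -/
theorem exists_unique_solution (hσ : Continuous σ) (hpos : ∀ s, 0 < σ s) (hlam : Continuous lam)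
    {σ₀ lam₀ : ℝ → ℝ} (hσ₀ : ∀ x, 0 ≤ x → σ₀ x = σ x) (hlam₀ : ∀ x, 0 ≤ x → lam₀ x = lam x)
    {F : ℝ → 𝓢'(Phase d, ℂ)} (hF : ContinuousOn F (Ici 0)) (G : 𝓢'(Phase d, ℂ)) :
    ∃ U : ℝ → 𝓢'(Phase d, ℂ), (IsC1 U ∧ IsSolution σ₀ lam₀ F G U) ∧
      (∀ W : ℝ → 𝓢'(Phase d, ℂ), IsC1 W → IsSolution σ₀ lam₀ F G W → EqOn W U (Ici 0)) ∧
      ∀ x, 0 ≤ x → ∀ φ, U x φ = SchwartzMap.duhamel (propagator d σ lam) F G x φ := by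
  have hQ := isEvolution_propagator (d := d) hσ hpos hlam
  choose! U hU using fun (x : ℝ) (hx : 0 ≤ x) => hQ.exists_distribution_eq_duhamel hF G hx
  -- The derivative is read off from the equation; at `x = 0` it gives the one-sided derivative.
  set U' : ℝ → 𝓢'(Phase d, ℂ) := fun x =>
    F x + PointwiseConvergenceCLM.precomp ℂ (generator d σ lam x) (U x) with hU'
  have hU'_apply : ∀ x φ, U' x φ = F x φ + U x (generator d σ lam x φ) := fun x φ => rfl
  have hderiv : ∀ x, 0 ≤ x → HasDeriv U (U' x) x := fun x hx => hasDeriv_iff.2 fun φ => by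
    rw [hU'_apply, hU x hx]
    exact (hQ.hasDerivWithinAt_duhamel hF G φ hx).congr (fun y hy => hU y hy φ) (hU x hx φ)
  refine ⟨U, ⟨⟨U', fun x hx => ?_, hderiv⟩, fun x hx => ⟨U' x, hderiv x hx.le, ?_⟩, ?_⟩,
    fun W hW hWs x hx => ?_, hU⟩
  · refine PointwiseConvergenceCLM.tendsto_iff_forall_tendsto.2 fun φ => ?_
    have h := (hQ.continuous_duhamel_generator hF G φ).continuousOn (s := Ici 0)
    refine (h.congr fun y hy => ?_) x hx
    rw [hU'_apply, hU y hy, max_eq_left (mem_Ici.1 hy)]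
  · rw [equation_iff (hσ₀ x hx.le) (hlam₀ x hx.le)]
    exact fun φ => (hU'_apply x φ).trans (add_comm _ _)
  · ext φ
    rw [hU 0 le_rfl, SchwartzMap.duhamel, intervalIntegral.integral_same, add_zero,
      hQ.apply_self 0 le_rfl]
  · obtain ⟨W', -, hW'⟩ := hW
    ext φ
    rw [hU x hx, hQ.eq_duhamel hF (fun x hx => hasDeriv_iff.1 (hW' x hx)) (fun y hy => ?_) hx φ,
      hWs.2]
    obtain ⟨V, hV, hVe⟩ := hWs.1 y hy
    rw [(hW' y hy.le).unique hy.le hV]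
    exact (equation_iff (hσ₀ y hy.le) (hlam₀ y hy.le)).1 hVe

end PencilBeam

end

theorem proposition4p1 (d : ℕ) (σ lam : ℝ → ℝ)
    (hσ : ContinuousOn σ (Ici 0)) (hlam : ContinuousOn lam (Ici 0))
    (hσ_pos : ∃ c : ℝ, 0 < c ∧ ∀ x, 0 ≤ x → c ≤ σ x)
    (hlam_pos : ∃ c : ℝ, 0 < c ∧ ∀ x, 0 ≤ x → c ≤ lam x)
    (F : ℝ → 𝓢'(PencilBeam.Phase d, ℂ)) (hF : ContinuousOn F (Ici 0))
    (G : 𝓢'(PencilBeam.Phase d, ℂ)) :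
    ∃ U : ℝ → 𝓢'(PencilBeam.Phase d, ℂ),
      -- `U` is a solution of class `C¹`
      (PencilBeam.IsC1 U ∧ PencilBeam.IsSolution σ lam F G U) ∧
      -- it is the only one (as a function on `[0, ∞)`)
      (∀ W : ℝ → 𝓢'(PencilBeam.Phase d, ℂ),
        PencilBeam.IsC1 W → PencilBeam.IsSolution σ lam F G W → EqOn W U (Ici 0)) ∧
      -- it is given by the explicit formula, the integral being taken in `𝓢'`
      (∀ x : ℝ, 0 < x → ∀ φ : 𝓢(PencilBeam.Phase d, ℂ),
        IntervalIntegrable (fun t => Real.exp (-∫ s in t..x, lam s) •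
          PencilBeam.translate x (PencilBeam.conv (PencilBeam.H₂ d σ x t)
            (PencilBeam.translate (-t) (F t))) φ) volume 0 x ∧
        U x φ = Real.exp (-∫ s in (0 : ℝ)..x, lam s) •
            PencilBeam.translate x (PencilBeam.conv (PencilBeam.H₁ d σ x) G) φ +
          ∫ t in (0 : ℝ)..x, Real.exp (-∫ s in t..x, lam s) •
            PencilBeam.translate x (PencilBeam.conv (PencilBeam.H₂ d σ x t)
              (PencilBeam.translate (-t) (F t))) φ) := by
  obtain ⟨c, hc, hcσ⟩ := hσ_pos
  -- Extending the coefficients by their value at `0` makes them continuous on `ℝ`, with `σ₁`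
  -- positive, and leaves every integral over `[t, x] ⊆ [0, ∞)` unchanged.
  set σ₁ : ℝ → ℝ := fun x => σ (max x 0) with hσ₁_def
  set lam₁ : ℝ → ℝ := fun x => lam (max x 0) with hlam₁_def
  have hσ₁ : Continuous σ₁ := hσ.comp_continuous (by fun_prop) fun x => le_max_right x 0
  have hlam₁ : Continuous lam₁ := hlam.comp_continuous (by fun_prop) fun x => le_max_right x 0
  have hpos : ∀ s, 0 < σ₁ s := fun s => hc.trans_le (hcσ _ (le_max_right _ _))
  have hσe : ∀ x, 0 ≤ x → σ x = σ₁ x := fun x hx => by simp only [hσ₁_def, max_eq_left hx]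
  have hlame : ∀ x, 0 ≤ x → lam x = lam₁ x := fun x hx => by simp only [hlam₁_def, max_eq_left hx]
  have hmoment : ∀ k t x, 0 ≤ t → t ≤ x →
      PencilBeam.moment σ k t x = PencilBeam.moment σ₁ k t x := fun k t x ht htx =>
    intervalIntegral.integral_congr fun s hs => by
      rw [uIcc_of_le htx] at hs
      simp only [hσe s (ht.trans hs.1)]
  have hdamp : ∀ t x, 0 ≤ t → t ≤ x →
      Real.exp (-∫ s in t..x, lam s) = PencilBeam.damping lam₁ t x := fun t x ht htx => by
    rw [PencilBeam.damping, intervalIntegral.integral_congr fun s hs => ?_]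
    rw [uIcc_of_le htx] at hs
    exact hlame s (ht.trans hs.1)
  obtain ⟨U, hU, huniq, hUd⟩ := PencilBeam.exists_unique_solution hσ₁ hpos hlam₁ hσe hlame hF G
  refine ⟨U, hU, huniq, fun x hx φ => ?_⟩
  have hG : Real.exp (-∫ s in (0 : ℝ)..x, lam s) •
      PencilBeam.translate x (PencilBeam.conv (PencilBeam.H₁ d σ x) G) φ =
        G (PencilBeam.propagator d σ₁ lam₁ 0 x φ) := by
    rw [hdamp 0 x le_rfl hx.le, ← PencilBeam.damping_smul_translate_conv hσ₁ hpos hx]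
    simp only [PencilBeam.H₁, hmoment _ 0 x le_rfl hx.le]
  have hFt : ∀ t ∈ Ioo 0 x, F t (PencilBeam.propagator d σ₁ lam₁ t x φ) =
      Real.exp (-∫ s in t..x, lam s) • PencilBeam.translate x (PencilBeam.conv
        (PencilBeam.H₂ d σ x t) (PencilBeam.translate (-t) (F t))) φ := fun t ht => by
    rw [hdamp t x ht.1.le ht.2.le,
      ← PencilBeam.damping_smul_translate_conv_translate hσ₁ hpos ht.2]
    simp only [PencilBeam.H₂, hmoment _ t x ht.1.le ht.2.le]
  have hint :=
    (PencilBeam.isEvolution_propagator (d := d) hσ₁ hpos hlam₁).intervalIntegrable_pairing hF hx.le φ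
  -- The kernel formula is unavailable at `t = x`, where the moments vanish, so the integrands are
  -- compared only almost everywhere.
  have hae : (fun t => F t (PencilBeam.propagator d σ₁ lam₁ t x φ)) =ᵐ[volume.restrict (uIoc 0 x)]
      fun t => Real.exp (-∫ s in t..x, lam s) • PencilBeam.translate x (PencilBeam.conv
        (PencilBeam.H₂ d σ x t) (PencilBeam.translate (-t) (F t))) φ := by
    rw [uIoc_of_le hx.le, ← restrict_Ioo_eq_restrict_Ioc]
    exact (ae_restrict_iff' measurableSet_Ioo).2 (ae_of_all _ hFt)
  refine ⟨hint.congr_ae hae, ?_⟩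
  rw [hUd x hx.le, SchwartzMap.duhamel, hG, intervalIntegral.integral_congr_ae_restrict hae]
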